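/- Let $\Omega$ be either a compact convex subset of $\mathbb{R}^d$ with nonempty interior or the flat torus $\mathbb{T}^d=\mathbb{R}^d/\mathbb{Z}^d$. Let $\mathcal{P}(\Omega)$ be the set of smooth probability densities on $\Omega$, and let $\mathrm{Dist}_{\mathrm T}$ be the $L^2$-Wasserstein distance on $\mathcal{P}(\Omega)$: $\mathrm{Dist}_{\mathrm T}(p,q)^2$ is the minimum of $\int d_\Omega(x,y)^2\,d\pi(x,y)$ over the couplings $\pi$ of $p$ and $q$, where $d_\Omega$ is the Euclidean distance (on the torus, the flat distance). A function $\eta\in C^\infty(\Omega)$ is called an $L^2$ first variation $\frac{\delta}{\delta q}G(q)$ of a functional $G\colon\mathcal{P}(\Omega)\to\mathbb{R}$ at $q$ if $\frac{d}{dt}\big|_{t=0}G(q+t\sigma)=\int_\Omega\eta\,\sigma\,dx$ for every $\sigma\in C^\infty(\Omega)$ with $\int_\Omega\sigma\,dx=0$ and $q+t\sigma\in\mathcal{P}(\Omega)$ for all small $|t|$. The tangent vectors at $q$ are the functions $\sigma=-\nabla\cdot(q\nabla\Psi)$, where $\Psi\in C^\infty(\Omega)$ satisfies $q\,\nabla\Psi\cdot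 n=0$ for every outward normal $n$ at every boundary point of $\Omega$ (no condition on the torus), and the Wasserstein metric is $g_{\mathrm T}(q)(\sigma_1,\sigma_2)=\int_\Omega(\nabla\Psi_1,\nabla\Psi_2)\,q\,dx$ for $\sigma_i=-\nabla\cdot(q\nabla\Psi_i)$. The Wasserstein gradient $\mathrm{grad}_{\mathrm T}\mathcal F(q)$ is the tangent vector with $g_{\mathrm T}(q)(\mathrm{grad}_{\mathrm T}\mathcal F(q),\sigma)=\int_\Omega\frac{\delta}{\delta q}\mathcal F(q)\,\sigma\,dx$ for every tangent vector $\sigma$ at $q$. Let $\mathcal F\colon\mathcal P(\Omega)\to\mathbb R$ and $p,q\in\mathcal P(\Omega)$, with $q>0$ in the interior of $\Omega$. Suppose that $\mathcal F$ has a (smooth) $L^2$ first variation $\frac{\delta}{\delta q}\mathcal F(q)$ at $q$ and that, if $\Omega$ is a convex body, $q\,\nabla\frac{\delta}{\delta q}\mathcal F(q)\cdot n=0$ for every outward normal $n$ at every boundary point. Suppose also that there is a smooth strictly convex function $\Phi_p$ (on the torus: a smooth strictly convex function on $\mathbb{R}^d$ with $\Phi_p(x)-\frac12\|x\|^2$ periodic)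 whose gradient $T=\nabla\Phi_p$ maps $\Omega$ (on the torus: $\mathbb{R}^d$) bijectively onto itself and pushes $q$ forward to $p$, i.e. $p(T(x))\det(\nabla T(x))=q(x)$. Define the transport Bregman divergence $$\mathrm D_{\mathrm T,\mathcal F}(p\|q)=\mathcal F(p)-\mathcal F(q)-\int_\Omega\Big(\nabla_x\tfrac{\delta}{\delta q(x)}\mathcal F(q),\,T(x)-x\Big)q(x)\,dx .$$ Then the Wasserstein gradient of $\mathcal F$ at $q$ exists, with $\mathrm{grad}_{\mathrm T}\mathcal F(q)=-\nabla_x\cdot\big(q\nabla_x\frac{\delta}{\delta q}\mathcal F(q)\big)$; the functional $r\mapsto\mathrm{Dist}_{\mathrm T}(p,r)^2$ has an $L^2$ first variation at $q$; and $$\mathrm D_{\mathrm T,\mathcal F}(p\|q)=\mathcal F(p)-\mathcal F(q)+\frac12\int_\Omega\mathrm{grad}_{\mathrm T}\mathcal F(q)(x)\cdot\frac{\delta}{\delta q(x)}\mathrm{Dist}_{\mathrm T}(p,q)^2\,dx ,$$ for every choice of the first variation of the squared distance (it is determined up to an additive constant). -/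

import Mathlib

open MeasureTheory Filter Topology Set
open scoped ContDiff RealInnerProductSpace

noncomputable section

/-- The sample spaces `Ω`: a compact convex subset of `ℝᵈ` with nonempty interior, or the flat
torus `ℝᵈ / ℤᵈ`. -/
inductive SampleSpace (d : ℕ) : Type
  | convexBody (K : Set (EuclideanSpace ℝ (Fin d))) (isCompact : IsCompact K)
      (convex : Convex ℝ K) (nonempty_interior : (interior K).Nonempty) : SampleSpace d
  | torus : SampleSpace d

namespace SampleSpace

variable {d : ℕ}

/-- The set on which functions on `Ω` are defined: `Ω` itself for a convex body. Functions on the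
torus are the `ℤᵈ`-periodic functions on `ℝᵈ`. -/
def cover : SampleSpace d → Set (EuclideanSpace ℝ (Fin d))
  | convexBody K _ _ _ => K
  | torus => univ

/-- The periods of functions on `Ω`: only `0` for a convex body, and `ℤᵈ` for the torus. -/
def periods : SampleSpace d → Set (EuclideanSpace ℝ (Fin d))
  | convexBody _ _ _ _ => {0}
  | torus => {k | ∀ i, ∃ m : ℤ, k i = m}

/-- The set over which one integrates: `Ω` for a convex body, and the unit cell `[0,1)ᵈ` for the
torus. -/
def cell : SampleSpace d → Set (EuclideanSpace ℝ (Fin d))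
  | convexBody K _ _ _ => K
  | torus => {x | ∀ i, x i ∈ Ico (0 : ℝ) 1}

/-- `f ∈ C^∞(Ω)` (smooth up to the boundary for a convex body, periodic for the torus). -/
def IsSmooth (X : SampleSpace d) (f : EuclideanSpace ℝ (Fin d) → ℝ) : Prop :=
  ContDiffOn ℝ ∞ f X.cover ∧ ∀ x ∈ X.cover, ∀ k ∈ X.periods, f (x + k) = f x

/-- The integral `∫_Ω f(x) dx`. -/
def integral (X : SampleSpace d) (f : EuclideanSpace ℝ (Fin d) → ℝ) : ℝ :=
  ∫ x in X.cell, f x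

/-- The spatial gradient `∇ₓ f` on `Ω`. -/
def grad (X : SampleSpace d) (f : EuclideanSpace ℝ (Fin d) → ℝ) :
    EuclideanSpace ℝ (Fin d) → EuclideanSpace ℝ (Fin d) :=
  gradientWithin f X.cover

/-- The spatial divergence `∇ₓ · v` on `Ω`. -/
def div (X : SampleSpace d) (v : EuclideanSpace ℝ (Fin d) → EuclideanSpace ℝ (Fin d))
    (x : EuclideanSpace ℝ (Fin d)) : ℝ :=
  ∑ i, (fderivWithin ℝ v X.cover x (EuclideanSpace.single i 1)) i

/-- The squared distance of `Ω`: `‖x - y‖²` for a convex body, and `min_{k ∈ ℤᵈ} ‖x - y - k‖²` for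
the torus. -/
def sqDist (X : SampleSpace d) (x y : EuclideanSpace ℝ (Fin d)) : ℝ :=
  ⨅ k : X.periods, ‖x - y - k‖ ^ 2

/-- The space `𝒫(Ω)` of smooth probability densities on `Ω`. (For a convex body a function on `Ω`
is extended by zero, so that two densities are equal iff they agree on `Ω`.) -/
structure Density (X : SampleSpace d) where
  toFun : EuclideanSpace ℝ (Fin d) → ℝ
  smooth : X.IsSmooth toFun
  nonneg : ∀ x ∈ X.cover, 0 ≤ toFun x
  integral_eq_one : X.integral toFun = 1
  eq_zero_of_notMem : ∀ x, x ∉ X.cover → toFun x = 0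

instance (X : SampleSpace d) :
    CoeFun (Density X) (fun _ => EuclideanSpace ℝ (Fin d) → ℝ) :=
  ⟨Density.toFun⟩

/-- The probability measure `p(x) dx` on `Ω` (for the torus: on its unit cell). -/
def Density.toMeasure {X : SampleSpace d} (p : Density X) :
    Measure (EuclideanSpace ℝ (Fin d)) :=
  (volume.restrict X.cell).withDensity (fun x => ENNReal.ofReal (p x))

/-- The `L²`-Wasserstein distance `Dist_T(p,q)`: the square root of the minimal quadratic cost of
the joint distributions `π` with marginals `p` and `q`. -/
def wassersteinDist (X : SampleSpace d) (p q : Density X) : ℝ :=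
  Real.sqrt (sInf {c : ℝ | ∃ π : Measure (EuclideanSpace ℝ (Fin d) × EuclideanSpace ℝ (Fin d)),
    π.map Prod.fst = p.toMeasure ∧ π.map Prod.snd = q.toMeasure ∧
      c = ∫ z, X.sqDist z.1 z.2 ∂π})

/-- `η = δG/δq(x)`: the smooth function `η` on `Ω` is an `L²` first variation of the functional
`G` at `q`, i.e. `d/dt G(q + t σ) = ∫ η σ dx` at `t = 0` for every smooth `σ` of zero mean such
that `q + t σ` is a density for all small `|t|`. (It is determined up to an additive constant.) -/
def IsFirstVariation (X : SampleSpace d) (G : Density X → ℝ) (q : Density X)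
    (η : EuclideanSpace ℝ (Fin d) → ℝ) : Prop :=
  X.IsSmooth η ∧
    ∀ σ : EuclideanSpace ℝ (Fin d) → ℝ, X.IsSmooth σ → X.integral σ = 0 →
      ∀ c : ℝ → Density X, (∀ᶠ t in 𝓝 (0 : ℝ), ∀ x ∈ X.cover, c t x = q x + t * σ x) →
        HasDerivAt (fun t => G (c t)) (X.integral fun x => η x * σ x) 0

/-- The function `-∇ₓ · (q ∇ₓ Φ)`. -/
def tangent (X : SampleSpace d) (q : Density X) (Φ : EuclideanSpace ℝ (Fin d) → ℝ) :
    EuclideanSpace ℝ (Fin d) → ℝ :=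
  fun x => -X.div (fun y => q y • X.grad Φ y) x

/-- `Φ ∈ C^∞(Ω)` is the potential of a tangent vector `-∇·(q ∇Φ)` at `q`: no mass flows through
the boundary, i.e. `q ∇Φ` is orthogonal to every outward normal `n` of `Ω`, at every point of `Ω`.
(On the torus, and in the interior of a convex body, the only normal is `n = 0`.) -/
def IsTangentPotential (X : SampleSpace d) (q : Density X)
    (Φ : EuclideanSpace ℝ (Fin d) → ℝ) : Prop :=
  X.IsSmooth Φ ∧
    ∀ x ∈ X.cover, ∀ n : EuclideanSpace ℝ (Fin d), (∀ y ∈ X.cover, ⟪n, y - x⟫ ≤ 0) →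
      q x * ⟪X.grad Φ x, n⟫ = 0

/-- The Wasserstein metric `g_T(q)(σ₁, σ₂) = ∫ (∇Φ₁, ∇Φ₂) q dx` of the tangent vectors
`σᵢ = -∇·(q ∇Φᵢ)`, in terms of their potentials. -/
def metric (X : SampleSpace d) (q : Density X) (Φ₁ Φ₂ : EuclideanSpace ℝ (Fin d) → ℝ) : ℝ :=
  X.integral fun x => ⟪X.grad Φ₁ x, X.grad Φ₂ x⟫ * q x

/-- `ζ = grad_T F(q)`, where `f` is the `L²` first variation of `F` at `q`: the function `ζ` on `Ω`
is a tangent vector at `q`, and `g_T(q)(ζ, σ) = ∫ f σ dx` for every tangent vector `σ` at `q`. -/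
def IsWassersteinGradient (X : SampleSpace d) (q : Density X)
    (f ζ : EuclideanSpace ℝ (Fin d) → ℝ) : Prop :=
  ∃ Ψ, X.IsTangentPotential q Ψ ∧ (∀ x ∈ X.cover, ζ x = X.tangent q Ψ x) ∧
    ∀ Φ, X.IsTangentPotential q Φ →
      X.metric q Ψ Φ = X.integral fun x => f x * X.tangent q Φ x

/-- `Φ = Φ_p` is the transport coordinate of `p` relative to `q`: a smooth strictly convex function
whose gradient `T = ∇Φ` maps `Ω` bijectively onto itself and pushes `q` forward to `p`, i.e.
`p(T(x)) det(∇T(x)) = q(x)`. (On the torus, `Φ - ‖x‖²/2` is periodic, so that `T(x) - x` is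
periodic, and `T` is the lift to `ℝᵈ` of a map of the torus.) -/
def IsTransportPotential (X : SampleSpace d) (q p : Density X)
    (Φ : EuclideanSpace ℝ (Fin d) → ℝ) : Prop :=
  X.IsSmooth (fun x => Φ x - ‖x‖ ^ 2 / 2) ∧ StrictConvexOn ℝ X.cover Φ ∧
    BijOn (X.grad Φ) X.cover X.cover ∧
    ∀ x ∈ X.cover, p (X.grad Φ x) * (fderivWithin ℝ (X.grad Φ) X.cover x).det = q x

/-- The transport Bregman divergence
`D_{T,F}(p‖q) = F(p) - F(q) - ∫ (∇ₓ f, ∇ₓ Φ - x) q dx`, where `f` is the `L²` first variation of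
`F` at `q` and `Φ` is the transport coordinate of `p` relative to `q`. -/
def transportBregman (X : SampleSpace d) (F : Density X → ℝ) (p q : Density X)
    (f Φ : EuclideanSpace ℝ (Fin d) → ℝ) : ℝ :=
  F p - F q - X.integral fun x => ⟪X.grad f x, X.grad Φ x - x⟫ * q x

end SampleSpace

end

/-! Everything rests on integration by parts, `integral_mul_tangent`: pairing a smooth `η` with the
tangent vector of `Ψ` gives `∫ ⟨∇Ψ, ∇η⟩ q`. By symmetry of this form, `f` is a potential of the
Wasserstein gradient; testing any other potential `Ψ` of it against `Ψ - f` gives `∇Ψ = ∇f` almost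
everywhere. The formula follows once the first variation of the squared distance is known to be `η =
‖x‖² - 2Φ` up to a constant: `∇η = 2(x - T)`, so half of `∫ ⟨∇f, ∇η⟩ q` is `-∫ ⟨∇f, T - x⟩ q`.

The boundary of a convex body need not be smooth, so the divergence theorem is read off from
volumes. For small `t`, `∫ det(1 + t Dv)` is at most the volume of the image under `x + t v(x)`. A
displacement tangent to the boundary leaves the body only to second order (on the torus the volume
cannot grow), so the derivative `∫ tr Dv` at `t = 0` vanishes.

The first variation of the distance comes from two bounds at `q + tσ`. Below: `η` and its
`c`-transform are admissible in the dual problem for every second marginal, and convexity of `Φ`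
makes them tight at `q`; this gives an affine function of `t`. Above: applying `T` to the first
coordinate of a coupling of `q` and `q + tσ` gives the same affine function plus a constant times
the quadratic cost of that coupling.

That cost must be `o(t)` although `q` may vanish at the boundary. In `exists_short_transport` mass
travels from `σ⁻` to `σ⁺` through a chain of `N` moves of length at most `D/N`, at total cost of
order `D²/N`. Each move takes mass present at an intermediate point; inside a convex core, where `q`
is bounded below, the laws of these points are dominated by a multiple of `q`, so `q` can supply the
mass for small `t`. The little mass outside the core moves in one jump. -/

section Determinant

/-! ### Determinants near the identity and the first variation of volume. -/

variable {E : Type*} [NormedAddCommGroup E] [NormedSpace ℝ E] [FiniteDimensional ℝ E]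

theorem ContinuousLinearMap.det_eq_det_toMatrix (A : E →L[ℝ] E) :
    A.det = ((LinearMap.toMatrix (Module.finBasis ℝ E) (Module.finBasis ℝ E))
      (A : E →ₗ[ℝ] E)).det := by
  rw [LinearMap.det_toMatrix]

/-- The determinant is a polynomial in the matrix entries. Its use is a Lipschitz bound on balls,
which justifies differentiation under the integral. -/
theorem ContinuousLinearMap.contDiff_det : ContDiff ℝ 1 fun A : E →L[ℝ] E => A.det := by
  simp_rw [ContinuousLinearMap.det_eq_det_toMatrix, Matrix.det_apply]
  refine ContDiff.sum fun σ _ => ContDiff.const_smul _ (contDiff_prod fun i _ => ?_)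
  let e : (E →L[ℝ] E) →ₗ[ℝ] ℝ :=
    (Matrix.entryLinearMap ℝ ℝ (σ i) i).comp
      ((LinearMap.toMatrix (Module.finBasis ℝ E) (Module.finBasis ℝ E)).toLinearMap.comp
        (ContinuousLinearMap.coeLM ℝ))
  exact (LinearMap.toContinuousLinearMap e).contDiff

theorem ContinuousLinearMap.hasDerivAt_det_one_add_smul (A : E →L[ℝ] E) :
    HasDerivAt (fun t : ℝ => (1 + t • A).det) (LinearMap.trace ℝ E A) 0 := by
  set b := Module.finBasis ℝ E
  set M := LinearMap.toMatrix b b (A : E →ₗ[ℝ] E)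
  -- The determinant is a polynomial in `t`; removing its two lowest coefficients leaves a remainder
  -- divisible by `t ^ 2`.
  have h1 : (fun t : ℝ => (1 + t • A).det) = fun t => 1 + M.trace * t +
      (Matrix.det (1 + (Polynomial.X : Polynomial ℝ) • M.map Polynomial.C)).divX.divX.eval t
        * t ^ 2 := by
    ext t
    rw [← Matrix.det_one_add_smul, ContinuousLinearMap.det_eq_det_toMatrix]
    congr 1
    have : ((1 + t • A : E →L[ℝ] E) : E →ₗ[ℝ] E) = LinearMap.id + t • (A : E →ₗ[ℝ] E) := rfl
    rw [this, map_add, map_smul, LinearMap.toMatrix_id]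
  rw [h1, LinearMap.trace_eq_matrix_trace ℝ b]
  have h2 := (((hasDerivAt_id (0 : ℝ)).const_mul M.trace).const_add 1).add
    ((Polynomial.hasDerivAt (Matrix.det (1 + (Polynomial.X : Polynomial ℝ) •
      M.map Polynomial.C)).divX.divX 0).mul (hasDerivAt_pow 2 (0 : ℝ)))
  exact h2.congr_deriv (by simp [M])

/-- If the displacements `x + t v(x)` do not increase the volume of `s` to first order in `t`, then
the divergence of `v` has zero mean on `s`. -/
theorem setIntegral_trace_fderiv_eq_zero [MeasurableSpace E] [BorelSpace E] {μ : Measure E}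
    [μ.IsAddHaarMeasure] {s : Set E} (hs : MeasurableSet s) (hμs : μ s ≠ ⊤) {v : E → E}
    {v' : E → E →L[ℝ] E} (hv : ∀ x ∈ s, HasFDerivWithinAt v (v' x) s x) {L : NNReal}
    (hv' : ∀ x ∈ s, ‖v' x‖ ≤ L) (hL : LipschitzOnWith L v s)
    (hm : AEStronglyMeasurable v' (μ.restrict s)) {G : ℝ → ℝ} (hG : HasDerivAt G 0 0)
    (hG0 : G 0 = 1) (hvol : ∀ᶠ t in 𝓝 (0 : ℝ),
      μ.real ((fun x => x + t • v x) '' s) ≤ G t * μ.real s) :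
    ∫ x in s, LinearMap.trace ℝ E (v' x) ∂μ = 0 := by
  have : ProperSpace (E →L[ℝ] E) := FiniteDimensional.proper ℝ _
  have : IsFiniteMeasure (μ.restrict s) := isFiniteMeasure_restrict.2 hμs
  -- For `|t| ≤ 1` the maps `1 + t • v' x` stay in the ball of radius `L` about `1`, so one
  -- Lipschitz constant serves all `x`.
  obtain ⟨K, hK⟩ := (ContinuousLinearMap.contDiff_det (E := E)).contDiffOn.exists_lipschitzOnWith
    one_ne_zero (convex_closedBall (1 : E →L[ℝ] E) L) (isCompact_closedBall _ _)
  have hball : ∀ x ∈ s, ∀ t ∈ Icc (-1 : ℝ) 1, 1 + t • v' x ∈ Metric.closedBall (1 : E →L[ℝ] E) L := by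
    intro x hx t ht
    rw [mem_closedBall_iff_norm, add_sub_cancel_left, norm_smul, Real.norm_eq_abs]
    calc |t| * ‖v' x‖ ≤ 1 * L := by gcongr; exacts [abs_le.2 ht, hv' x hx]
      _ = L := one_mul _
  have hder := hasDerivAt_integral_of_dominated_loc_of_lip (μ := μ.restrict s) (𝕜 := ℝ)
    (F := fun t x => (1 + t • v' x).det) (F' := fun x => LinearMap.trace ℝ E (v' x))
    (x₀ := 0) (s := Icc (-1) 1) (bound := fun _ => K * L)
    (Icc_mem_nhds (by norm_num) (by norm_num))
    (Eventually.of_forall fun t => ContinuousLinearMap.continuous_det.comp_aestronglyMeasurable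
      (aestronglyMeasurable_const.add (hm.const_smul t)))
    (by simp [ContinuousLinearMap.det])
    (((LinearMap.trace ℝ E).comp (ContinuousLinearMap.coeLM ℝ)).continuous_of_finiteDimensional.comp_aestronglyMeasurable hm)
    (by
      filter_upwards [ae_restrict_mem hs] with x hx
      refine LipschitzOnWith.of_dist_le_mul fun a ha b hb => ?_
      refine (hK.dist_le_mul _ (hball x hx a ha) _ (hball x hx b hb)).trans ?_
      rw [dist_eq_norm, add_sub_add_left_eq_sub, ← sub_smul, norm_smul, ← dist_eq_norm]
      have h0 : (0 : ℝ) ≤ K * L := by positivity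
      rw [Real.coe_nnabs, abs_of_nonneg h0, mul_assoc, mul_comm (dist a b)]
      gcongr
      exact hv' x hx)
    (integrable_const _)
    (by
      filter_upwards with x
      exact ContinuousLinearMap.hasDerivAt_det_one_add_smul _)
  obtain ⟨-, hder⟩ := hder
  set D : ℝ → ℝ := fun t => ∫ x in s, (1 + t • v' x).det ∂μ
  have hD : ∀ᶠ t in 𝓝 (0 : ℝ), D t ≤ G t * μ.real s := by
    have h1 : ∀ᶠ t : ℝ in 𝓝 0, |t| * (L : ℝ) < 1 := by
      have : Tendsto (fun t : ℝ => |t| * (L : ℝ)) (𝓝 0) (𝓝 (|0| * L)) := by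
        exact (continuous_abs.mul continuous_const).tendsto 0
      rw [abs_zero, zero_mul] at this
      exact this.eventually_lt_const one_pos
    filter_upwards [h1, hvol, Icc_mem_nhds (show (-1 : ℝ) < 0 by norm_num) one_pos] with t ht h2 htI
    refine le_trans ?_ h2
    -- Since `|t| L < 1`, the perturbation of the identity is a strict contraction; hence the area
    -- formula applies.
    have hinj : InjOn (fun x => x + t • v x) s := by
      intro x hx y hy hxy
      by_contra hne
      have h3 : x - y = t • (v y - v x) := by
        rw [smul_sub]
        simp only at hxy
        rw [sub_eq_sub_iff_add_eq_add, hxy, add_comm]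
      have h4 : ‖x - y‖ ≤ |t| * (L * ‖x - y‖) := by
        conv_lhs => rw [h3]
        rw [norm_smul, Real.norm_eq_abs]
        gcongr
        rw [norm_sub_rev x y, ← dist_eq_norm, ← dist_eq_norm]
        exact hL.dist_le_mul y hy x hx
      have h5 : 0 < ‖x - y‖ := norm_pos_iff.2 (sub_ne_zero.2 hne)
      nlinarith
    have hfd : ∀ x ∈ s, HasFDerivWithinAt (fun x => x + t • v x) (1 + t • v' x) s x :=
      fun x hx => (hasFDerivWithinAt_id x s).add ((hv x hx).const_smul t)
    have h3 := lintegral_abs_det_fderiv_eq_addHaar_image μ hs hfd hinj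
    have h4 : ∀ x ∈ s, |(1 + t • v' x).det| ≤ 1 + K * L := by
      intro x hx
      have h5 := hK.dist_le_mul _ (hball x hx t htI) _
        (Metric.mem_closedBall_self (by positivity))
      have h6 : (1 : E →L[ℝ] E).det = 1 := by simp [ContinuousLinearMap.det]
      rw [h6, Real.dist_eq] at h5
      have h7 := mem_closedBall_iff_norm.1 (hball x hx t htI)
      rw [← dist_eq_norm] at h7
      have h8 : (K : ℝ) * dist (1 + t • v' x) 1 ≤ K * L := by gcongr
      have h9 := abs_sub_abs_le_abs_sub (1 + t • v' x).det 1
      rw [abs_one] at h9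
      linarith
    have hmeas : AEStronglyMeasurable (fun x => (1 + t • v' x).det) (μ.restrict s) :=
      ContinuousLinearMap.continuous_det.comp_aestronglyMeasurable
        (aestronglyMeasurable_const.add (hm.const_smul t))
    have hint : Integrable (fun x => (1 + t • v' x).det) (μ.restrict s) :=
      Integrable.of_bound hmeas (1 + K * L) (by
        filter_upwards [ae_restrict_mem hs] with x hx using h4 x hx)
    rw [Measure.real, ← h3, ← integral_eq_lintegral_of_nonneg_ae
      (Eventually.of_forall fun x => abs_nonneg _) hmeas.norm]
    exact integral_mono hint hint.abs fun x => le_abs_self _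
  -- The difference is nonpositive near `0` and zero at `0`. The bound holds on both sides of `0`,
  -- so the derivative vanishes.
  have hmax : IsLocalMax (fun t => D t - G t * μ.real s) 0 := by
    filter_upwards [hD] with t ht
    have : D 0 = μ.real s := by simp [D, ContinuousLinearMap.det]
    rw [this, hG0]
    linarith
  have := hmax.hasDerivAt_eq_zero (hder.sub (hG.mul_const _))
  simpa using this

end Determinant

/-! ### Displacements tangent to the boundary of a convex body. -/

section TangentialDisplacement

variable {E : Type*} [NormedAddCommGroup E] [InnerProductSpace ℝ E]

/-- After division by `1 + κ`, with `a` as origin, `z` is the convex combination of `y` and of the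
point `a + κ⁻¹ • (z - y)` of the inscribed ball. -/
theorem mem_image_homothety_of_norm_sub_le {K : Set E} (hK : Convex ℝ K) {a : E} {r : ℝ}
    (ha : Metric.closedBall a r ⊆ K) {y z : E} (hy : y ∈ K) {κ : ℝ} (hκ : 0 ≤ κ)
    (hz : ‖z - y‖ ≤ κ * r) : z ∈ AffineMap.homothety a (1 + κ) '' K := by
  have h1 : 0 < 1 + κ := by linarith
  rcases hκ.eq_or_lt with rfl | hκ'
  · rw [zero_mul] at hz
    rw [norm_le_zero_iff, sub_eq_zero] at hz
    exact ⟨y, hy, by simp [hz]⟩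
  have hw : a + κ⁻¹ • (z - y) ∈ K := by
    refine ha ?_
    rw [mem_closedBall_iff_norm, add_sub_cancel_left, norm_smul, norm_inv, Real.norm_eq_abs,
      abs_of_pos hκ', inv_mul_le_iff₀ hκ']
    exact hz
  refine ⟨(1 / (1 + κ)) • y + (κ / (1 + κ)) • (a + κ⁻¹ • (z - y)),
    hK hy hw (by positivity) (by positivity) (by field_simp), ?_⟩
  rw [AffineMap.homothety_apply, vsub_eq_sub, vadd_eq_add, smul_sub, smul_add, smul_smul,
    smul_smul, mul_one_div_cancel h1.ne', mul_div_cancel₀ _ h1.ne', smul_add, smul_smul,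
    mul_inv_cancel₀ hκ'.ne', add_smul]
  module

/-- A displacement along a Lipschitz field which is tangent to the boundary of a convex body leaves
the body only to second order. -/
theorem image_add_smul_subset_homothety {K : Set E} (hK : Convex ℝ K) (hc : IsCompact K) {a : E}
    {r : ℝ} (hr : 0 < r) (ha : Metric.closedBall a r ⊆ K) {v : E → E} {L : NNReal} {B : ℝ}
    (hL : LipschitzOnWith L v K) (hB : ∀ x ∈ K, ‖v x‖ ≤ B) (hB0 : 0 ≤ B)
    (hv : ∀ x ∈ K, ∀ n : E, (∀ y ∈ K, ⟪n, y - x⟫ ≤ 0) → ⟪v x, n⟫ = 0) (t : ℝ) :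
    (fun x => x + t • v x) '' K ⊆ AffineMap.homothety a (1 + 2 * L * B / r * t ^ 2) '' K := by
  rintro _ ⟨x, hx, rfl⟩
  set z := x + t • v x with hzdef
  -- Take `y` to be the projection of `z` onto `K`: then `z - y` is an outward normal at `y`, hence
  -- orthogonal to `v y`.
  obtain ⟨y, hy, hyz⟩ := exists_norm_eq_iInf_of_complete_convex ⟨x, hx⟩ hc.isComplete hK z
  have hn := (norm_eq_iInf_iff_real_inner_le_zero hK hy).1 hyz
  refine mem_image_homothety_of_norm_sub_le hK ha hy (by positivity) ?_
  have hzx : ‖z - x‖ ≤ |t| * B := by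
    rw [hzdef, add_sub_cancel_left, norm_smul, Real.norm_eq_abs]
    gcongr
    exact hB x hx
  have hzy : ‖z - y‖ ≤ ‖z - x‖ := by
    rw [hyz]
    exact ciInf_le ⟨0, by rintro _ ⟨w, rfl⟩; exact norm_nonneg _⟩ (⟨x, hx⟩ : K)
  have hxy : ‖x - y‖ ≤ 2 * |t| * B := by
    have : x - y = (z - y) - (z - x) := by abel
    rw [this]
    refine (norm_sub_le _ _).trans ?_
    linarith
  have h1 : ‖z - y‖ ^ 2 = ⟪z - y, x - y⟫ + t * ⟪z - y, v x - v y⟫ := by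
    have h2 : ⟪z - y, v y⟫ = 0 := by
      rw [real_inner_comm]
      exact hv y hy _ hn
    rw [inner_sub_right (z - y) (v x), h2, sub_zero, ← real_inner_smul_right, ← inner_add_right,
      ← real_inner_self_eq_norm_sq]
    congr 1
    rw [hzdef]
    abel
  have h3 : t * ⟪z - y, v x - v y⟫ ≤ |t| * (‖z - y‖ * (L * (2 * |t| * B))) := by
    refine (le_abs_self _).trans ?_
    rw [abs_mul]
    gcongr
    refine (abs_real_inner_le_norm _ _).trans ?_
    gcongr
    have := hL.dist_le_mul x hx y hy
    rw [dist_eq_norm, dist_eq_norm] at this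
    exact this.trans (by gcongr)
  -- The term `⟪z - y, x - y⟫` is nonpositive by the projection inequality. In the other one, `t`
  -- meets `v x - v y`, itself of order `t`.
  have h4 : ‖z - y‖ ^ 2 ≤ ‖z - y‖ * (2 * L * B * t ^ 2) := by
    have := hn x hx
    rw [← sq_abs t]
    nlinarith
  have h5 : 2 * L * B / r * t ^ 2 * r = 2 * L * B * t ^ 2 := by field_simp
  rw [h5]
  rcases (norm_nonneg (z - y)).eq_or_lt with h6 | h6
  · rw [← h6]; positivity
  · rw [pow_two] at h4
    exact le_of_mul_le_mul_left h4 h6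

end TangentialDisplacement

/-! ### Geometry of the sample spaces: cells, periods, smooth functions. -/

namespace SampleSpace

variable {d : ℕ} (X : SampleSpace d)

theorem convex_cover : Convex ℝ X.cover := by
  cases X with
  | convexBody K _ hK _ => exact hK
  | torus => exact convex_univ

theorem isClosed_cover : IsClosed X.cover := by
  cases X with
  | convexBody K hK _ _ => exact hK.isClosed
  | torus => exact isClosed_univ

theorem nonempty_interior_cover : (interior X.cover).Nonempty := by
  cases X with
  | convexBody K _ _ hK => exact hK
  | torus => simp [cover]

theorem uniqueDiffOn_cover : UniqueDiffOn ℝ X.cover :=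
  uniqueDiffOn_convex X.convex_cover X.nonempty_interior_cover

/-- The unit cell of the torus is the fundamental domain of the standard lattice. -/
theorem cell_torus : (torus : SampleSpace d).cell =
    ZSpan.fundamentalDomain (EuclideanSpace.basisFun (Fin d) ℝ).toBasis := by
  ext x
  simp [cell, ZSpan.fundamentalDomain]

theorem periods_torus : (torus : SampleSpace d).periods =
    Submodule.span ℤ (range (EuclideanSpace.basisFun (Fin d) ℝ).toBasis) := by
  ext x
  rw [SetLike.mem_coe, Module.Basis.mem_span_iff_repr_mem]
  simp [periods, eq_comm]

theorem convex_cell : Convex ℝ X.cell := by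
  cases X with
  | convexBody K _ hK _ => exact hK
  | torus =>
    intro x hx y hy a b ha hb hab i
    exact convex_Ico (0 : ℝ) 1 (hx i) (hy i) ha hb hab

theorem measurableSet_cell : MeasurableSet X.cell := by
  cases X with
  | convexBody K hK _ _ => exact hK.measurableSet
  | torus =>
    rw [cell_torus]
    exact ZSpan.fundamentalDomain_measurableSet _

theorem isBounded_cell : Bornology.IsBounded X.cell := by
  cases X with
  | convexBody K hK _ _ => exact hK.isBounded
  | torus =>
    rw [cell_torus]
    exact ZSpan.fundamentalDomain_isBounded _

theorem cell_subset_cover : X.cell ⊆ X.cover := by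
  cases X with
  | convexBody K _ _ _ => exact subset_rfl
  | torus => exact subset_univ _

theorem isCompact_closure_cell : IsCompact (closure X.cell) := X.isBounded_cell.isCompact_closure

theorem closure_cell_subset_cover : closure X.cell ⊆ X.cover :=
  closure_minimal X.cell_subset_cover X.isClosed_cover

/-- The frontier of a convex set is null, so positivity of `q` in the interior amounts to positivity
almost everywhere. -/
theorem ae_mem_interior_cell : ∀ᵐ x ∂(volume.restrict X.cell), x ∈ interior X.cell := by
  have h := X.convex_cell.addHaar_frontier volume
  have h2 : ∀ᵐ x : EuclideanSpace ℝ (Fin d), x ∉ frontier X.cell := measure_eq_zero_iff_ae_notMem.1 h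
  filter_upwards [ae_restrict_mem X.measurableSet_cell, ae_restrict_of_ae h2] with x hx hx2
  by_contra h3
  exact hx2 ⟨subset_closure hx, h3⟩

theorem volume_cell_ne_top : volume X.cell ≠ ⊤ := X.isBounded_cell.measure_lt_top.ne

instance : IsFiniteMeasure (volume.restrict X.cell) :=
  isFiniteMeasure_restrict.2 X.volume_cell_ne_top

theorem nonempty_cover : X.cover.Nonempty := X.nonempty_interior_cover.mono interior_subset

theorem zero_mem_periods : 0 ∈ X.periods := by
  cases X with
  | convexBody K _ _ _ => exact mem_singleton _
  | torus => rw [periods_torus]; exact zero_mem _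

theorem add_mem_periods {k l : EuclideanSpace ℝ (Fin d)} (hk : k ∈ X.periods)
    (hl : l ∈ X.periods) : k + l ∈ X.periods := by
  cases X with
  | convexBody K _ _ _ => rw [mem_singleton_iff.1 hk, zero_add]; exact hl
  | torus => rw [periods_torus] at *; exact add_mem hk hl

theorem neg_mem_periods {k : EuclideanSpace ℝ (Fin d)} (hk : k ∈ X.periods) :
    -k ∈ X.periods := by
  cases X with
  | convexBody K _ _ _ => rw [mem_singleton_iff.1 hk, neg_zero]; exact mem_singleton _
  | torus => rw [periods_torus] at *; exact neg_mem hk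

instance : Nonempty X.periods := ⟨⟨0, X.zero_mem_periods⟩⟩

instance countable_span_basisFun : Countable
    (Submodule.span ℤ (range (EuclideanSpace.basisFun (Fin d) ℝ).toBasis)) :=
  TopologicalSpace.separableSpace_iff_countable.1 inferInstance

theorem countable_periods : X.periods.Countable := by
  cases X with
  | convexBody K _ _ _ => exact countable_singleton _
  | torus =>
    rw [periods_torus]
    exact Set.countable_coe_iff.1 countable_span_basisFun

instance : Countable X.periods := X.countable_periods.to_subtype

theorem add_mem_cover {x k : EuclideanSpace ℝ (Fin d)} (hx : x ∈ X.cover)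
    (hk : k ∈ X.periods) : x + k ∈ X.cover := by
  cases X with
  | convexBody K _ _ _ => rw [mem_singleton_iff.1 hk, add_zero]; exact hx
  | torus => exact mem_univ _

/-- Translates of the cell by different periods are disjoint. -/
theorem eq_of_mem_cell_of_add_mem_cell {x k : EuclideanSpace ℝ (Fin d)} (hx : x ∈ X.cell)
    (hk : k ∈ X.periods) (hxk : x + k ∈ X.cell) : k = 0 := by
  cases X with
  | convexBody K _ _ _ => exact hk
  | torus =>
    ext i
    obtain ⟨m, hm⟩ := hk i
    have h1 := hx i
    have h2 := hxk i
    rw [PiLp.add_apply, hm] at h2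
    have h3 : (m : ℝ) < 1 := by linarith [h1.1, h2.2]
    have h4 : (-1 : ℝ) < m := by linarith [h1.2, h2.1]
    have h5 : m < 1 := by exact_mod_cast h3
    have h6 : -1 < m := by exact_mod_cast h4
    have h7 : m = 0 := by omega
    rw [hm, h7]; simp

/-- On the torus, take fractional parts. This brings points of the cover back to a bounded set,
measurably and modulo periods. -/
theorem exists_reduction : ∃ R : EuclideanSpace ℝ (Fin d) → EuclideanSpace ℝ (Fin d),
    Measurable R ∧ ∀ x ∈ X.cover, R x ∈ X.cell ∧ ∃ k ∈ X.periods, R x = x + k := by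
  cases X with
  | convexBody K _ _ _ =>
    exact ⟨id, measurable_id, fun x hx => ⟨hx, 0, mem_singleton _, by simp⟩⟩
  | torus =>
    refine ⟨fun x => WithLp.toLp 2 fun i => Int.fract (x i), ?_, fun x _ => ⟨fun i => ?_, ?_⟩⟩
    · refine (PiLp.continuous_toLp 2 _).measurable.comp (measurable_pi_lambda _ fun i => ?_)
      exact measurable_fract.comp (EuclideanSpace.proj i).continuous.measurable
    · exact ⟨Int.fract_nonneg _, Int.fract_lt_one _⟩
    · refine ⟨WithLp.toLp 2 fun i => -(⌊x i⌋ : ℝ), fun i => ⟨-⌊x i⌋, by simp⟩, ?_⟩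
      ext i
      simp [Int.fract, sub_eq_add_neg]

variable {X}

theorem cell_subset_interior_cover : interior X.cell ⊆ interior X.cover :=
  interior_mono X.cell_subset_cover

namespace IsSmooth

variable {f g : EuclideanSpace ℝ (Fin d) → ℝ}

theorem continuousOn (hf : X.IsSmooth f) : ContinuousOn f X.cover := hf.1.continuousOn

theorem const (c : ℝ) : X.IsSmooth fun _ => c := ⟨contDiffOn_const, fun _ _ _ _ => rfl⟩

theorem add (hf : X.IsSmooth f) (hg : X.IsSmooth g) : X.IsSmooth fun x => f x + g x :=
  ⟨hf.1.add hg.1, fun x hx k hk => by simp only [hf.2 x hx k hk, hg.2 x hx k hk]⟩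

theorem sub (hf : X.IsSmooth f) (hg : X.IsSmooth g) : X.IsSmooth fun x => f x - g x :=
  ⟨hf.1.sub hg.1, fun x hx k hk => by simp only [hf.2 x hx k hk, hg.2 x hx k hk]⟩

theorem mul (hf : X.IsSmooth f) (hg : X.IsSmooth g) : X.IsSmooth fun x => f x * g x :=
  ⟨hf.1.mul hg.1, fun x hx k hk => by simp only [hf.2 x hx k hk, hg.2 x hx k hk]⟩

theorem neg (hf : X.IsSmooth f) : X.IsSmooth fun x => -f x :=
  ⟨hf.1.neg, fun x hx k hk => by simp only [hf.2 x hx k hk]⟩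

theorem const_mul (hf : X.IsSmooth f) (c : ℝ) : X.IsSmooth fun x => c * f x := (const c).mul hf

theorem congr (hf : X.IsSmooth f) (h : ∀ x ∈ X.cover, g x = f x) : X.IsSmooth g :=
  ⟨hf.1.congr h, fun x hx k hk => by
    rw [h x hx, h _ (X.add_mem_cover hx hk), hf.2 x hx k hk]⟩

theorem exists_bound (hf : ContinuousOn f X.cover) : ∃ C, ∀ x ∈ X.cell, |f x| ≤ C := by
  obtain ⟨C, hC⟩ := X.isCompact_closure_cell.exists_bound_of_continuousOn
    (hf.mono X.closure_cell_subset_cover)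
  exact ⟨C, fun x hx => hC x (subset_closure hx)⟩

theorem exists_bound_cover (hf : X.IsSmooth f) : ∃ C, ∀ x ∈ X.cover, |f x| ≤ C := by
  obtain ⟨C, hC⟩ := exists_bound hf.continuousOn
  obtain ⟨R, -, hR⟩ := X.exists_reduction
  refine ⟨C, fun x hx => ?_⟩
  obtain ⟨h1, k, hk, h2⟩ := hR x hx
  rw [← hf.2 x hx k hk, ← h2]
  exact hC _ h1

end IsSmooth

theorem aestronglyMeasurable_cell {F : Type*} [NormedAddCommGroup F]
    {f : EuclideanSpace ℝ (Fin d) → F} (hf : ContinuousOn f X.cover) :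
    AEStronglyMeasurable f (volume.restrict X.cell) :=
  (hf.mono X.cell_subset_cover).aestronglyMeasurable X.measurableSet_cell

theorem integrableOn_cell {F : Type*} [NormedAddCommGroup F]
    {f : EuclideanSpace ℝ (Fin d) → F} (hf : ContinuousOn f X.cover) :
    IntegrableOn f X.cell :=
  ((hf.mono X.closure_cell_subset_cover).integrableOn_compact
    X.isCompact_closure_cell).mono_set subset_closure

theorem integral_congr {f g : EuclideanSpace ℝ (Fin d) → ℝ} (h : ∀ x ∈ X.cover, f x = g x) :
    X.integral f = X.integral g :=
  setIntegral_congr_fun X.measurableSet_cell fun x hx => h x (X.cell_subset_cover hx)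

theorem fderivWithin_add_period {F : Type*} [NormedAddCommGroup F] [NormedSpace ℝ F]
    {v : EuclideanSpace ℝ (Fin d) → F}
    (hv : ∀ x ∈ X.cover, ∀ k ∈ X.periods, v (x + k) = v x) {x k : EuclideanSpace ℝ (Fin d)}
    (hk : k ∈ X.periods) :
    fderivWithin ℝ v X.cover (x + k) = fderivWithin ℝ v X.cover x := by
  cases X with
  | convexBody K _ _ _ => rw [mem_singleton_iff.1 hk, add_zero]
  | torus =>
    simp only [cover, fderivWithin_univ]
    rw [← fderiv_comp_add_right]
    congr 1
    ext x
    exact hv x (mem_univ _) k hk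

theorem div_eq_trace (v : EuclideanSpace ℝ (Fin d) → EuclideanSpace ℝ (Fin d))
    (x : EuclideanSpace ℝ (Fin d)) :
    X.div v x = LinearMap.trace ℝ _
      (fderivWithin ℝ v X.cover x : EuclideanSpace ℝ (Fin d) →ₗ[ℝ] EuclideanSpace ℝ (Fin d)) := by
  rw [LinearMap.trace_eq_sum_inner _ (EuclideanSpace.basisFun (Fin d) ℝ)]
  simp [div, EuclideanSpace.inner_single_left]

/-- The lattice translates of `s` are disjoint; cutting `s` along the translates of the unit cell
and moving the pieces back packs it into one cell. -/
theorem volume_torus_le {s : Set (EuclideanSpace ℝ (Fin d))} (hs : NullMeasurableSet s volume)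
    (h : ∀ x ∈ s, ∀ k ∈ (torus : SampleSpace d).periods, x + k ∈ s → k = 0) :
    volume s ≤ volume (torus : SampleSpace d).cell := by
  rw [cell_torus]
  have : Countable (Submodule.span ℤ
      (range (EuclideanSpace.basisFun (Fin d) ℝ).toBasis)).toAddSubgroup :=
    countable_span_basisFun
  have h0 := ZSpan.isAddFundamentalDomain' (EuclideanSpace.basisFun (Fin d) ℝ).toBasis volume
  refine h0.measure_le_of_pairwise_disjoint hs (Pairwise.aedisjoint fun g₁ g₂ hne => ?_)
  refine (Disjoint.inf_left _ ?_).inf_right _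
  rw [Set.disjoint_left]
  rintro _ ⟨x, hx, rfl⟩ ⟨y, hy, hxy⟩
  apply hne
  have hxy' : (g₂ : EuclideanSpace ℝ (Fin d)) + y = g₁ + x := hxy
  have hk : (g₁ - g₂ : EuclideanSpace ℝ (Fin d)) ∈ (torus : SampleSpace d).periods := by
    rw [periods_torus]
    exact sub_mem g₁.2 g₂.2
  have := h x hx _ hk (by
    have : x + (g₁ - g₂ : EuclideanSpace ℝ (Fin d)) = y := by
      rw [← sub_eq_zero] at hxy' ⊢
      rw [← neg_eq_zero, ← hxy']
      abel
    rwa [this])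
  exact Subtype.ext (sub_eq_zero.1 this)

end SampleSpace

/-! ### The divergence theorem, integration by parts and the Wasserstein gradient. -/

namespace SampleSpace

variable {d : ℕ} {X : SampleSpace d}

theorem eventually_volume_image_add_smul_le {v : EuclideanSpace ℝ (Fin d) → EuclideanSpace ℝ (Fin d)}
    (hv : ContinuousOn v X.cover) (hper : ∀ x ∈ X.cover, ∀ k ∈ X.periods, v (x + k) = v x)
    (hflux : ∀ x ∈ X.cover, ∀ n, (∀ y ∈ X.cover, ⟪n, y - x⟫ ≤ 0) → ⟪v x, n⟫ = 0)
    {L : NNReal} (hL : LipschitzOnWith L v X.cover) :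
    ∃ C : ℝ, ∀ᶠ t in 𝓝 (0 : ℝ), volume.real ((fun x => x + t • v x) '' X.cell) ≤
      (1 + C * t ^ 2) ^ d * volume.real X.cell := by
  cases X with
  | convexBody K hK hc hi =>
    obtain ⟨a, ha⟩ := hi
    obtain ⟨r, hr, har⟩ := Metric.nhds_basis_closedBall.mem_iff.1 (mem_interior_iff_mem_nhds.1 ha)
    obtain ⟨B, hB⟩ := hK.exists_bound_of_continuousOn hv
    have hB0 : 0 ≤ B := (norm_nonneg _).trans (hB a (interior_subset ha))
    -- The image lies in a homothetic copy of `K` of ratio `1 + 2 L B t² / r`, whose volume scales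
    -- by the power `d` of the ratio.
    refine ⟨2 * L * B / r, Eventually.of_forall fun t => ?_⟩
    have h1 := image_add_smul_subset_homothety hc hK hr har hL hB hB0 hflux t
    have h2 : volume (AffineMap.homothety a (1 + 2 * L * B / r * t ^ 2) '' K) =
        ENNReal.ofReal ((1 + 2 * L * B / r * t ^ 2) ^ d) * volume K := by
      rw [Measure.addHaar_image_homothety, finrank_euclideanSpace_fin, abs_of_nonneg (by positivity)]
    refine (measureReal_mono h1 ?_).trans_eq ?_
    · rw [h2]
      exact ENNReal.mul_ne_top ENNReal.ofReal_ne_top hK.measure_ne_top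
    · rw [Measure.real, h2, ENNReal.toReal_mul, ENNReal.toReal_ofReal (by positivity)]
      rfl
  | torus =>
    refine ⟨0, ?_⟩
    have h1 : ∀ᶠ t : ℝ in 𝓝 0, |t| * (L : ℝ) < 1 := by
      have : Tendsto (fun t : ℝ => |t| * (L : ℝ)) (𝓝 0) (𝓝 (|0| * L)) :=
        (continuous_abs.mul continuous_const).tendsto 0
      rw [abs_zero, zero_mul] at this
      exact this.eventually_lt_const one_pos
    filter_upwards [h1] with t ht
    -- The displaced map is injective on `ℝᵈ` and commutes with periods, so the image of the cell
    -- meets each lattice orbit at most once.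
    have hinj : Function.Injective (fun x => x + t • v x) := by
      intro x y hxy
      by_contra hne
      have h3 : x - y = t • (v y - v x) := by
        rw [smul_sub]
        simp only at hxy
        rw [sub_eq_sub_iff_add_eq_add, hxy, add_comm]
      have h4 : ‖x - y‖ ≤ |t| * (L * ‖x - y‖) := by
        conv_lhs => rw [h3]
        rw [norm_smul, Real.norm_eq_abs]
        gcongr
        rw [norm_sub_rev x y, ← dist_eq_norm, ← dist_eq_norm]
        exact hL.dist_le_mul y (mem_univ _) x (mem_univ _)
      have h5 : 0 < ‖x - y‖ := norm_pos_iff.2 (sub_ne_zero.2 hne)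
      nlinarith
    have hcont : Continuous (fun x => x + t • v x) :=
      continuous_id.add ((continuousOn_univ.1 hv).const_smul t)
    have hmeas : MeasurableSet ((fun x => x + t • v x) '' (torus : SampleSpace d).cell) :=
      (hcont.measurableEmbedding hinj).measurableSet_image' torus.measurableSet_cell
    have h2 := volume_torus_le hmeas.nullMeasurableSet (by
      rintro _ ⟨x, hx, rfl⟩ k hk ⟨y, hy, hxy⟩
      have h3 : y = x + k := hinj (by
        simp only at hxy ⊢
        rw [hxy, hper x (mem_univ _) k hk]
        abel)
      subst h3
      exact torus.eq_of_mem_cell_of_add_mem_cell hx hk hy)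
    simpa [Measure.real] using ENNReal.toReal_mono torus.volume_cell_ne_top h2

/-- By periodicity the derivative is bounded by its supremum over the compact closure of the cell;
convexity of the cover turns this into a Lipschitz bound. -/
theorem exists_lipschitzOnWith_cover {v : EuclideanSpace ℝ (Fin d) → EuclideanSpace ℝ (Fin d)}
    (hv : ContDiffOn ℝ 1 v X.cover) (hper : ∀ x ∈ X.cover, ∀ k ∈ X.periods, v (x + k) = v x) :
    ∃ L : NNReal, (∀ x ∈ X.cover, ‖fderivWithin ℝ v X.cover x‖ ≤ L) ∧
      LipschitzOnWith L v X.cover := by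
  have h1 : ContinuousOn (fderivWithin ℝ v X.cover) X.cover :=
    hv.continuousOn_fderivWithin X.uniqueDiffOn_cover le_rfl
  obtain ⟨C, hC⟩ := X.isCompact_closure_cell.exists_bound_of_continuousOn
    (h1.mono X.closure_cell_subset_cover)
  obtain ⟨R, -, hR⟩ := X.exists_reduction
  have h2 : ∀ x ∈ X.cover, ‖fderivWithin ℝ v X.cover x‖ ≤ C.toNNReal := by
    intro x hx
    obtain ⟨h3, k, hk, h4⟩ := hR x hx
    rw [← fderivWithin_add_period hper hk, ← h4]
    exact (hC _ (subset_closure h3)).trans (Real.le_coe_toNNReal C)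
  refine ⟨C.toNNReal, h2, ?_⟩
  exact X.convex_cover.lipschitzOnWith_of_nnnorm_hasFDerivWithin_le
    (fun x hx => (hv.differentiableOn one_ne_zero x hx).hasFDerivWithinAt)
    fun x hx => h2 x hx

/-- The divergence theorem on `Ω`, for a vector field which is tangent to the boundary. -/
theorem integral_div_eq_zero {v : EuclideanSpace ℝ (Fin d) → EuclideanSpace ℝ (Fin d)}
    (hv : ContDiffOn ℝ 1 v X.cover) (hper : ∀ x ∈ X.cover, ∀ k ∈ X.periods, v (x + k) = v x)
    (hflux : ∀ x ∈ X.cover, ∀ n, (∀ y ∈ X.cover, ⟪n, y - x⟫ ≤ 0) → ⟪v x, n⟫ = 0) :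
    X.integral (X.div v) = 0 := by
  obtain ⟨L, hL', hL⟩ := exists_lipschitzOnWith_cover hv hper
  obtain ⟨C, hC⟩ := eventually_volume_image_add_smul_le hv.continuousOn hper hflux hL
  have hG : HasDerivAt (fun t : ℝ => (1 + C * t ^ 2) ^ d) 0 0 := by
    have := ((((hasDerivAt_pow 2 (0 : ℝ)).const_mul C).const_add 1).pow d)
    exact this.congr_deriv (by simp)
  have := setIntegral_trace_fderiv_eq_zero (μ := volume) X.measurableSet_cell X.volume_cell_ne_top
    (fun x hx => ((hv.differentiableOn one_ne_zero x
      (X.cell_subset_cover hx)).hasFDerivWithinAt).mono X.cell_subset_cover)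
    (fun x hx => hL' x (X.cell_subset_cover hx)) (hL.mono X.cell_subset_cover)
    (aestronglyMeasurable_cell (hv.continuousOn_fderivWithin X.uniqueDiffOn_cover le_rfl))
    hG (by simp) hC
  rw [integral]
  simpa only [div_eq_trace] using this

theorem IsSmooth.grad_contDiffOn {f : EuclideanSpace ℝ (Fin d) → ℝ} (hf : X.IsSmooth f) :
    ContDiffOn ℝ ∞ (X.grad f) X.cover :=
  (InnerProductSpace.toDual ℝ _).symm.toContinuousLinearEquiv.contDiff.comp_contDiffOn
    (hf.1.fderivWithin X.uniqueDiffOn_cover (by simp))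

theorem IsSmooth.grad_add_period {f : EuclideanSpace ℝ (Fin d) → ℝ} (hf : X.IsSmooth f)
    {x k : EuclideanSpace ℝ (Fin d)} (hk : k ∈ X.periods) : X.grad f (x + k) = X.grad f x := by
  simp only [grad, gradientWithin, fderivWithin_add_period hf.2 hk]

theorem IsSmooth.differentiableWithinAt {f : EuclideanSpace ℝ (Fin d) → ℝ} (hf : X.IsSmooth f)
    {x : EuclideanSpace ℝ (Fin d)} (hx : x ∈ X.cover) : DifferentiableWithinAt ℝ f X.cover x :=
  hf.1.differentiableOn (by simp) x hx

theorem inner_grad (f : EuclideanSpace ℝ (Fin d) → ℝ) (x w : EuclideanSpace ℝ (Fin d)) :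
    ⟪X.grad f x, w⟫ = fderivWithin ℝ f X.cover x w := by
  simp [grad, gradientWithin, InnerProductSpace.toDual_symm_apply]

theorem grad_sub {f g : EuclideanSpace ℝ (Fin d) → ℝ} {x : EuclideanSpace ℝ (Fin d)}
    (hx : x ∈ X.cover) (hf : DifferentiableWithinAt ℝ f X.cover x)
    (hg : DifferentiableWithinAt ℝ g X.cover x) :
    X.grad (fun y => f y - g y) x = X.grad f x - X.grad g x := by
  simp only [grad, gradientWithin]
  rw [fderivWithin_fun_sub (X.uniqueDiffOn_cover x hx) hf hg, map_sub]

theorem div_smul {η : EuclideanSpace ℝ (Fin d) → ℝ}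
    {v : EuclideanSpace ℝ (Fin d) → EuclideanSpace ℝ (Fin d)} {x : EuclideanSpace ℝ (Fin d)}
    (hx : x ∈ X.cover) (hη : DifferentiableWithinAt ℝ η X.cover x)
    (hv : DifferentiableWithinAt ℝ v X.cover x) :
    X.div (fun y => η y • v y) x = η x * X.div v x + ⟪X.grad η x, v x⟫ := by
  rw [inner_grad]
  simp only [div]
  rw [fderivWithin_fun_smul (X.uniqueDiffOn_cover x hx) hη hv]
  simp only [_root_.add_apply, _root_.smul_apply,
    ContinuousLinearMap.smulRight_apply, PiLp.add_apply, PiLp.smul_apply, smul_eq_mul,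
    Finset.sum_add_distrib, Finset.mul_sum]
  congr 1
  conv_rhs => rw [← (EuclideanSpace.basisFun (Fin d) ℝ).sum_repr (v x)]
  simp [mul_comm]

/-- Integration by parts against the tangent vector of a potential. -/
theorem integral_mul_tangent {q : Density X} {Ψ η : EuclideanSpace ℝ (Fin d) → ℝ}
    (hΨ : X.IsTangentPotential q Ψ) (hη : X.IsSmooth η) :
    X.integral (fun x => η x * X.tangent q Ψ x) = X.metric q Ψ η := by
  have hv : ContDiffOn ℝ ∞ (fun y => q y • X.grad Ψ y) X.cover :=
    q.smooth.1.smul hΨ.1.grad_contDiffOn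
  have hper : ∀ x ∈ X.cover, ∀ k ∈ X.periods,
      q (x + k) • X.grad Ψ (x + k) = q x • X.grad Ψ x := fun x hx k hk => by
    rw [q.smooth.2 x hx k hk, hΨ.1.grad_add_period hk]
  -- Multiplication by `η` preserves tangency of the flux to the boundary, so the divergence theorem
  -- applies to the product field.
  have h0 := integral_div_eq_zero (X := X) (v := fun y => η y • q y • X.grad Ψ y)
    ((hη.1.smul hv).of_le (by simp))
    (fun x hx k hk => by rw [hη.2 x hx k hk, hper x hx k hk])
    (fun x hx n hn => by
      rw [real_inner_smul_left, real_inner_smul_left, hΨ.2 x hx n hn, mul_zero])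
  have h1 : X.integral (X.div fun y => η y • q y • X.grad Ψ y) = X.integral fun x =>
      η x * X.div (fun y => q y • X.grad Ψ y) x + ⟪X.grad Ψ x, X.grad η x⟫ * q x := by
    refine integral_congr fun x hx => ?_
    rw [div_smul hx (hη.differentiableWithinAt hx) (hv.differentiableOn (by simp) x hx),
      real_inner_smul_right, real_inner_comm, mul_comm (q x)]
  have hdiv : ContinuousOn (X.div fun y => q y • X.grad Ψ y) X.cover := by
    have : ContinuousOn (fderivWithin ℝ (fun y => q y • X.grad Ψ y) X.cover) X.cover :=
      hv.continuousOn_fderivWithin X.uniqueDiffOn_cover (by simp)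
    refine continuousOn_finsetSum _ fun i _ => ?_
    exact (EuclideanSpace.proj (𝕜 := ℝ) i).continuous.comp_continuousOn
      (this.clm_apply continuousOn_const)
  rw [h1, integral, integral_add] at h0
  · have h2 : X.integral (fun x => η x * X.tangent q Ψ x) =
        -∫ x in X.cell, η x * X.div (fun y => q y • X.grad Ψ y) x := by
      rw [integral, ← integral_neg]
      simp only [tangent, mul_neg]
    rw [h2, metric, integral]
    linarith
  · exact integrableOn_cell (hη.continuousOn.mul hdiv)
  · exact integrableOn_cell ((hΨ.1.grad_contDiffOn.continuousOn.inner
      hη.grad_contDiffOn.continuousOn).mul q.smooth.continuousOn)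

theorem isWassersteinGradient_tangent {q : Density X} {f : EuclideanSpace ℝ (Fin d) → ℝ}
    (hf : X.IsTangentPotential q f) : X.IsWassersteinGradient q f (X.tangent q f) := by
  refine ⟨f, hf, fun _ _ => rfl, fun Φ hΦ => ?_⟩
  rw [integral_mul_tangent hΦ hf.1]
  simp only [metric, real_inner_comm]

end SampleSpace

/-! ### Rearranging mass by short moves. -/

section ShortTransport

open scoped ENNReal

variable {E : Type*} [NormedAddCommGroup E] [NormedSpace ℝ E] [FiniteDimensional ℝ E]
  [MeasurableSpace E] [BorelSpace E]

theorem MeasureTheory.Measure.smul_le_smul_of_le {α : Type*} [MeasurableSpace α] {μ ν : Measure α}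
    {a b : ℝ≥0∞} (hab : a ≤ b) (h : μ ≤ ν) : a • μ ≤ b • ν :=
  Measure.le_iff.2 fun s _ => by
    simp only [Measure.smul_apply, smul_eq_mul]
    exact mul_le_mul' hab (h s)

/-- The law of the point which divides the segment between two independent points has a bounded
density. -/
theorem map_lineMap_prod_le {vol : Measure E} [vol.IsAddHaarMeasure] {μ ν : Measure E}
    [IsFiniteMeasure μ] [IsFiniteMeasure ν] {c : Set E} (hc : Convex ℝ c) (hcm : MeasurableSet c)
    (hμ : μ cᶜ = 0) (hν : ν cᶜ = 0) {B : ℝ≥0∞} (hB : ν ≤ B • vol) {s : ℝ} (hs : 0 < s)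
    (hs1 : s ≤ 1) :
    (μ.prod ν).map (fun z => AffineMap.lineMap z.1 z.2 s) ≤
      (B * (ENNReal.ofReal (s ^ Module.finrank ℝ E))⁻¹ * μ univ) • vol.restrict c := by
  have hmeas : Measurable fun z : E × E => AffineMap.lineMap (k := ℝ) z.1 z.2 s := by
    simp only [AffineMap.lineMap_apply, vsub_eq_sub, vadd_eq_add]
    fun_prop
  have key : ∀ A, MeasurableSet A → (μ.prod ν).map (fun z => AffineMap.lineMap z.1 z.2 s) A ≤
      B * (ENNReal.ofReal (s ^ Module.finrank ℝ E))⁻¹ * μ univ * vol A := by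
    intro A hA
    rw [Measure.map_apply hmeas hA, Measure.prod_apply (hmeas hA)]
    have : ∀ x, ν (Prod.mk x ⁻¹' ((fun z : E × E => AffineMap.lineMap (k := ℝ) z.1 z.2 s) ⁻¹' A)) ≤
        B * (ENNReal.ofReal (s ^ Module.finrank ℝ E))⁻¹ * vol A := by
      intro x
      refine (hB _).trans ?_
      rw [Measure.smul_apply, smul_eq_mul, mul_assoc]
      gcongr
      -- With `x` fixed, the dividing point is the image of `y` under the homothety of ratio `s`
      -- centred at `x`, which scales volume by `s ^ dim`.
      have h1 : AffineMap.homothety x s '' (Prod.mk x ⁻¹'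
          ((fun z : E × E => AffineMap.lineMap (k := ℝ) z.1 z.2 s) ⁻¹' A)) ⊆ A := by
        rintro _ ⟨y, hy, rfl⟩
        simpa [AffineMap.homothety_apply, AffineMap.lineMap_apply] using hy
      have h2 := measure_mono (μ := vol) h1
      rw [Measure.addHaar_image_homothety, abs_of_pos (by positivity)] at h2
      rw [← ENNReal.div_eq_inv_mul]
      rwa [ENNReal.le_div_iff_mul_le, mul_comm]
      · left
        exact (ENNReal.ofReal_pos.2 (by positivity)).ne'
      · left
        exact ENNReal.ofReal_ne_top
    refine (lintegral_mono this).trans_eq ?_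
    rw [lintegral_const]
    ring
  refine Measure.le_iff.2 fun A hA => ?_
  have h0 : (μ.prod ν).map (fun z => AffineMap.lineMap z.1 z.2 s) cᶜ = 0 := by
    rw [Measure.map_apply hmeas hcm.compl]
    have : (fun z : E × E => AffineMap.lineMap (k := ℝ) z.1 z.2 s) ⁻¹' cᶜ ⊆
        cᶜ ×ˢ univ ∪ univ ×ˢ cᶜ := by
      rintro ⟨x, y⟩ hz
      by_contra h
      simp only [mem_union, mem_prod, mem_compl_iff, mem_univ, and_true, true_and, not_or,
        not_not] at h
      exact hz (hc.lineMap_mem h.1 h.2 ⟨hs.le, hs1⟩)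
    refine measure_mono_null this (measure_union_null ?_ ?_)
    · rw [Measure.prod_prod, hμ, zero_mul]
    · rw [Measure.prod_prod, hν, mul_zero]
  rw [← measure_inter_add_sdiff A hcm, sdiff_eq, measure_mono_null inter_subset_right h0, add_zero,
    Measure.smul_apply, smul_eq_mul, Measure.restrict_apply hA]
  exact key _ (hA.inter hcm)

omit [NormedSpace ℝ E] [FiniteDimensional ℝ E] [BorelSpace E] in
theorem lintegral_enorm_sq_le_of_ae {m : Measure (E × E)} {D : ℝ≥0∞}
    (h : ∀ᵐ z ∂m, ‖z.1 - z.2‖ₑ ≤ D) : ∫⁻ z, ‖z.1 - z.2‖ₑ ^ 2 ∂m ≤ D ^ 2 * m univ := by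
  rw [← lintegral_const]
  refine lintegral_mono_ae ?_
  filter_upwards [h] with z hz
  gcongr

/-- Mass can be rearranged by many short moves, at an arbitrarily small quadratic cost, in such a
way that the mass to be moved is dominated by a multiple of a given distribution. -/
theorem exists_short_transport {vol : Measure E} [vol.IsAddHaarMeasure] {Q μ ν : Measure E}
    [IsFiniteMeasure μ] [IsFiniteMeasure ν] {C B : ℝ≥0∞} (hC : C ≠ ⊤) (hB : B ≠ ⊤)
    (hμ : μ ≤ C • Q) (hν : ν ≤ C • Q) (hQ : Q ≤ B • vol) (hmass : μ univ = ν univ)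
    {S : Set E} (hS : Bornology.IsBounded S) (hQS : Q Sᶜ = 0)
    (hcore : ∀ ε : ℝ≥0∞, ε ≠ 0 → ∃ c, MeasurableSet c ∧ Convex ℝ c ∧ Q cᶜ ≤ ε ∧
      ∃ b : ℝ≥0∞, b ≠ ⊤ ∧ vol.restrict c ≤ b • Q)
    {ε : ℝ≥0∞} (hε : ε ≠ 0) :
    ∃ m : Measure (E × E), ∃ C' : ℝ≥0∞, C' ≠ ⊤ ∧ m.map Prod.fst ≤ C' • Q ∧
      m.map Prod.snd + μ = m.map Prod.fst + ν ∧ ∫⁻ z, ‖z.1 - z.2‖ₑ ^ 2 ∂m ≤ ε := by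
  rcases eq_or_ne (μ univ) 0 with hM0 | hM0
  · have h1 : μ = 0 := Measure.measure_univ_eq_zero.1 hM0
    have h2 : ν = 0 := Measure.measure_univ_eq_zero.1 (hmass ▸ hM0)
    exact ⟨0, 0, by simp, by simp, by simp [h1, h2], by simp⟩
  set M := μ univ with hM
  have hMt : M ≠ ⊤ := measure_ne_top _ _
  obtain ⟨D, hD⟩ : ∃ D : NNReal, ∀ x ∈ S, ∀ y ∈ S, ‖x - y‖ₑ ≤ D := by
    obtain ⟨D, hD⟩ := Metric.isBounded_iff.1 hS
    refine ⟨D.toNNReal, fun x hx y hy => ?_⟩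
    rw [enorm_le_coe, ← NNReal.coe_le_coe, coe_nnnorm, ← dist_eq_norm]
    exact (hD hx hy).trans (Real.le_coe_toNNReal D)
  have hε2 : ε / 2 ≠ 0 := (ENNReal.half_pos hε).ne'
  -- Half of `ε` pays for the jumps outside the core, of mass at most `(C + C) δ`; the other half
  -- pays for the chain, of cost at most `D² M / N`.
  obtain ⟨δ, hδ, hδε⟩ := ENNReal.exists_nnreal_pos_mul_lt (a := (D : ℝ≥0∞) ^ 2 * (C + C))
    (ENNReal.mul_ne_top (by simp) (by simp [hC])) hε2
  obtain ⟨N, hN, hNε⟩ := ENNReal.exists_nat_pos_inv_mul_lt (a := (D : ℝ≥0∞) ^ 2 * M)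
    (ENNReal.mul_ne_top (by simp) hMt) hε2
  obtain ⟨c, hcm, hcc, hQc, b, hb, hbc⟩ := hcore δ (by simpa using hδ.ne')
  set m₀ : Measure (E × E) := M⁻¹ • μ.prod ν with hm₀
  have hfst : m₀.map Prod.fst = μ := by
    rw [hm₀, Measure.map_smul, Measure.map_fst_prod, smul_smul, ← hmass,
      ENNReal.inv_mul_cancel hM0 hMt, one_smul]
  have hsnd : m₀.map Prod.snd = ν := by
    rw [hm₀, Measure.map_smul, Measure.map_snd_prod, smul_smul,
      ENNReal.inv_mul_cancel hM0 hMt, one_smul]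
  have hfin : m₀ univ = M := by
    rw [hM, ← hfst, Measure.map_apply measurable_fst .univ, preimage_univ]
  have hdist : ∀ᵐ z ∂m₀, ‖z.1 - z.2‖ₑ ≤ D := by
    have h1 : μ Sᶜ = 0 := by simpa [hQS] using hμ Sᶜ
    have h2 : ν Sᶜ = 0 := by simpa [hQS] using hν Sᶜ
    have h3 : m₀ (Sᶜ ×ˢ univ ∪ univ ×ˢ Sᶜ) = 0 := by
      refine measure_union_null ?_ ?_ <;> simp [hm₀, Measure.prod_prod, h1, h2]
    filter_upwards [measure_eq_zero_iff_ae_notMem.1 h3] with z hz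
    simp only [mem_union, mem_prod, mem_compl_iff, mem_univ, and_true, true_and, not_or,
      not_not] at hz
    exact hD _ hz.1 _ hz.2
  set R : Set (E × E) := c ×ˢ c
  have hR : MeasurableSet R := hcm.prod hcm
  set mc := m₀.restrict R with hmc
  set mo := m₀.restrict Rᶜ with hmo
  have hsplit : mc + mo = m₀ := Measure.restrict_add_restrict_compl hR
  have hNr : (0 : ℝ) < N := by exact_mod_cast hN
  let h : ℕ → E × E → E := fun k z => AffineMap.lineMap z.1 z.2 (k / N : ℝ)
  have hh : ∀ k, Measurable (h k) := fun k => by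
    simp only [h, AffineMap.lineMap_apply, vsub_eq_sub, vadd_eq_add]
    fun_prop
  have hh2 : ∀ k, Measurable fun z => (h k z, h (k + 1) z) := fun k => (hh k).prodMk (hh (k + 1))
  have h0 : h 0 = Prod.fst := by ext z; simp [h]
  have hN1 : h N = Prod.snd := by
    ext z
    simp [h, div_self hNr.ne']
  have hfsth : ∀ k, (mc.map fun z => (h k z, h (k + 1) z)).map Prod.fst = mc.map (h k) :=
    fun k => by
      rw [Measure.map_map measurable_fst (hh2 k)]
      rfl
  have hsndh : ∀ k, (mc.map fun z => (h k z, h (k + 1) z)).map Prod.snd = mc.map (h (k + 1)) :=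
    fun k => by
      rw [Measure.map_map measurable_snd (hh2 k)]
      rfl
  have hmc_le : mc ≤ m₀ := Measure.restrict_le_self
  have hmo_le : mo ≤ m₀ := Measure.restrict_le_self
  have hmc_prod : mc = M⁻¹ • (μ.restrict c).prod (ν.restrict c) := by
    rw [hmc, hm₀, Measure.restrict_smul, Measure.prod_restrict]
  have hfstm : (mo + ∑ k ∈ Finset.range N, mc.map fun z => (h k z, h (k + 1) z)).map Prod.fst =
      mo.map Prod.fst + ∑ k ∈ Finset.range N, mc.map (h k) := by
    rw [Measure.map_add _ _ measurable_fst, Measure.map_finset_sum measurable_fst.aemeasurable]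
    simp only [hfsth]
  have hsndm : (mo + ∑ k ∈ Finset.range N, mc.map fun z => (h k z, h (k + 1) z)).map Prod.snd =
      mo.map Prod.snd + ∑ k ∈ Finset.range N, mc.map (h (k + 1)) := by
    rw [Measure.map_add _ _ measurable_snd, Measure.map_finset_sum measurable_snd.aemeasurable]
    simp only [hsndh]
  have hbound : ∀ k ∈ Finset.range N, ∃ C' : ℝ≥0∞, C' ≠ ⊤ ∧ mc.map (h k) ≤ C' • Q := by
    intro k hk
    -- The density bound degenerates at `s = 0`, but there the moved mass starts from `μ`, dominated
    -- by hypothesis.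
    rcases Nat.eq_zero_or_pos k with rfl | hk0
    · refine ⟨C, hC, ?_⟩
      rw [h0]
      exact ((Measure.map_mono hmc_le measurable_fst).trans_eq hfst).trans hμ
    · have hkr : (0 : ℝ) < k := by exact_mod_cast hk0
      have hs : (0 : ℝ) < k / N := by positivity
      have hs1 : (k / N : ℝ) ≤ 1 := by
        rw [div_le_one hNr]
        exact_mod_cast (Finset.mem_range.1 hk).le
      have h3 := map_lineMap_prod_le (vol := vol) (μ := μ.restrict c) (ν := ν.restrict c)
        (B := C * B) hcc hcm (by simp [Measure.restrict_apply hcm.compl])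
        (by simp [Measure.restrict_apply hcm.compl])
        (Measure.restrict_le_self.trans (hν.trans (by
          rw [← smul_smul]
          exact Measure.smul_le_smul_of_le le_rfl hQ))) hs hs1
      refine ⟨M⁻¹ * (C * B * (ENNReal.ofReal ((k / N : ℝ) ^ Module.finrank ℝ E))⁻¹ *
        (μ.restrict c) univ * b), ?_, ?_⟩
      · refine ENNReal.mul_ne_top (by simpa using hM0) (ENNReal.mul_ne_top (ENNReal.mul_ne_top
          (ENNReal.mul_ne_top (ENNReal.mul_ne_top hC hB) ?_) (measure_ne_top _ _)) hb)
        rw [ne_eq, ENNReal.inv_eq_top]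
        exact (ENNReal.ofReal_pos.2 (by positivity)).ne'
      · rw [hmc_prod, Measure.map_smul, ← smul_smul]
        refine Measure.smul_le_smul_of_le le_rfl (h3.trans ?_)
        rw [← smul_smul _ b]
        exact Measure.smul_le_smul_of_le le_rfl hbc
  choose! C' hC' hC'le using hbound
  refine ⟨mo + ∑ k ∈ Finset.range N, mc.map (fun z => (h k z, h (k + 1) z)),
    C + ∑ k ∈ Finset.range N, C' k, ?_, ?_, ?_, ?_⟩
  · exact ENNReal.add_ne_top.2 ⟨hC, ENNReal.sum_ne_top.2 hC'⟩
  · rw [hfstm, add_smul, Finset.sum_smul]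
    refine add_le_add ?_ (Finset.sum_le_sum hC'le)
    exact ((Measure.map_mono hmo_le measurable_fst).trans_eq hfst).trans hμ
  · rw [hfstm, hsndm, ← hfst, ← hsnd, ← hsplit, Measure.map_add _ _ measurable_fst,
      Measure.map_add _ _ measurable_snd]
    -- Each intermediate law is both the arrival of one move and the departure of the next, so the
    -- chain telescopes.
    have h3 : ∑ k ∈ Finset.range N, mc.map (h (k + 1)) + mc.map Prod.fst =
        ∑ k ∈ Finset.range N, mc.map (h k) + mc.map Prod.snd := by
      rw [← h0, ← hN1, ← Finset.sum_range_succ' (fun k => mc.map (h k)),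
        ← Finset.sum_range_succ (fun k => mc.map (h k))]
    calc _ = (∑ k ∈ Finset.range N, mc.map (h (k + 1)) + mc.map Prod.fst) +
          (mo.map Prod.snd + mo.map Prod.fst) := by abel
      _ = _ := by rw [h3]; abel
  · rw [lintegral_add_measure, lintegral_finsetSum_measure]
    have hm1 : ∫⁻ z, ‖z.1 - z.2‖ₑ ^ 2 ∂mo ≤ ε / 2 := by
      have h1 : m₀ Rᶜ ≤ (C + C) * δ := by
        have h2 : Rᶜ ⊆ Prod.fst ⁻¹' cᶜ ∪ Prod.snd ⁻¹' cᶜ := by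
          intro z hz
          simp only [R, mem_compl_iff, mem_prod, not_and_or] at hz
          exact hz
        refine (measure_mono h2).trans ((measure_union_le _ _).trans ?_)
        rw [← Measure.map_apply measurable_fst hcm.compl,
          ← Measure.map_apply measurable_snd hcm.compl, hfst, hsnd, add_mul]
        refine add_le_add ((hμ _).trans ?_) ((hν _).trans ?_) <;>
        · rw [Measure.smul_apply, smul_eq_mul]
          gcongr
      refine (lintegral_enorm_sq_le_of_ae (ae_restrict_of_ae hdist)).trans ?_
      rw [Measure.restrict_apply_univ]
      refine le_trans ?_ hδε.le
      rw [mul_comm (δ : ℝ≥0∞), mul_assoc]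
      gcongr
    have hm2 : ∑ k ∈ Finset.range N, ∫⁻ z, ‖z.1 - z.2‖ₑ ^ 2
        ∂(mc.map fun z => (h k z, h (k + 1) z)) ≤ ε / 2 := by
      refine le_trans ?_ hNε.le
      have h1 : ∀ k ∈ Finset.range N, ∫⁻ z, ‖z.1 - z.2‖ₑ ^ 2
          ∂(mc.map fun z => (h k z, h (k + 1) z)) ≤ (D * (N : ℝ≥0∞)⁻¹) ^ 2 * M := by
        intro k _
        have hk : ∀ᵐ z ∂(mc.map fun z => (h k z, h (k + 1) z)),
            ‖z.1 - z.2‖ₑ ≤ D * (N : ℝ≥0∞)⁻¹ := by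
          refine (ae_map_iff (hh2 k).aemeasurable ?_).2 ?_
          · exact measurableSet_le (measurable_fst.sub measurable_snd).enorm measurable_const
          filter_upwards [ae_restrict_of_ae hdist] with z hz
          have h4 : h k z - h (k + 1) z = (N : ℝ)⁻¹ • (z.1 - z.2) := by
            simp only [h, AffineMap.lineMap_apply, vsub_eq_sub, vadd_eq_add]
            push_cast
            rw [add_div, add_smul, inv_eq_one_div]
            module
          rw [h4, enorm_smul, mul_comm, enorm_inv hNr.ne', Real.enorm_natCast]
          gcongr
        refine (lintegral_enorm_sq_le_of_ae hk).trans ?_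
        gcongr
        rw [Measure.map_apply (hh2 k) .univ, preimage_univ, ← hfin]
        exact hmc_le _
      refine (Finset.sum_le_sum h1).trans_eq ?_
      rw [Finset.sum_const, Finset.card_range, nsmul_eq_mul]
      have h5 : (N : ℝ≥0∞) * (N : ℝ≥0∞)⁻¹ = 1 :=
        ENNReal.mul_inv_cancel (by simpa using hN.ne') (by simp)
      calc (N : ℝ≥0∞) * ((D * (N : ℝ≥0∞)⁻¹) ^ 2 * M)
          = (N * (N : ℝ≥0∞)⁻¹) * ((N : ℝ≥0∞)⁻¹ * (D ^ 2 * M)) := by ring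
        _ = _ := by rw [h5, one_mul]
    exact (add_le_add hm1 hm2).trans_eq (ENNReal.add_halves ε)

/-- The coupling in which a small proportion of the mass is moved. -/
theorem exists_coupling_of_transport {Q Q' μ ν : Measure E} [IsFiniteMeasure Q]
    [IsFiniteMeasure μ] {m : Measure (E × E)}
    {C : ℝ≥0∞} (hm : m.map Prod.fst ≤ C • Q) (hμν : m.map Prod.snd + μ = m.map Prod.fst + ν)
    {t : ℝ≥0∞} (ht : t ≠ ⊤) (htC : t * C ≤ 1) (hQ' : Q' + t • μ = Q + t • ν) :
    ∃ γ : Measure (E × E), γ.map Prod.fst = Q ∧ γ.map Prod.snd = Q' ∧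
      ∫⁻ z, ‖z.1 - z.2‖ₑ ^ 2 ∂γ = t * ∫⁻ z, ‖z.1 - z.2‖ₑ ^ 2 ∂m := by
  set m₁ := m.map Prod.fst
  have hle : t • m₁ ≤ Q := by
    refine (Measure.smul_le_smul_of_le le_rfl hm).trans ?_
    rw [smul_smul]
    exact (Measure.smul_le_smul_of_le htC le_rfl).trans_eq (one_smul _ _)
  have hfin : IsFiniteMeasure (t • m₁) := ⟨(hle univ).trans_lt (measure_lt_top _ _)⟩
  have hdiag : Measurable fun x : E => (x, x) := measurable_id.prodMk measurable_id
  have hsub : Q - t • m₁ + t • m₁ = Q := Measure.sub_add_cancel_of_le hle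
  -- The mass `Q - t • m₁` stays in place on the diagonal, at no cost; `t • m` moves the rest.
  refine ⟨(Q - t • m₁).map (fun x => (x, x)) + t • m, ?_, ?_, ?_⟩
  · rw [Measure.map_add _ _ measurable_fst, Measure.map_map measurable_fst hdiag,
      Measure.map_smul]
    convert hsub
    exact Measure.map_id
  · have h1 : ((Q - t • m₁).map (fun x => (x, x)) + t • m).map Prod.snd =
        (Q - t • m₁) + t • m.map Prod.snd := by
      rw [Measure.map_add _ _ measurable_snd, Measure.map_map measurable_snd hdiag,
        Measure.map_smul]
      congr 1
      exact Measure.map_id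
    rw [h1]
    have h2 : (Q - t • m₁) + t • m.map Prod.snd + t • μ = Q' + t • μ := by
      rw [add_assoc, ← smul_add, hμν, smul_add, ← add_assoc, hsub, hQ']
    ext s hs
    have h3 := congrArg (fun ρ : Measure E => ρ s) h2
    simp only [Measure.add_apply] at h3
    have h4 : (t • μ) s ≠ ⊤ := by
      rw [Measure.smul_apply, smul_eq_mul]
      exact ENNReal.mul_ne_top ht (measure_ne_top _ _)
    rw [Measure.add_apply]
    exact (ENNReal.add_left_inj h4).1 h3
  · rw [lintegral_add_measure, lintegral_smul_measure, lintegral_map _ hdiag]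
    · simp
    · exact (measurable_fst.sub measurable_snd).enorm.pow_const 2

end ShortTransport

/-- Cover `K` by finitely many convex hulls of finite sets inside `U`; the hull of all these
vertices is compact and still inside `U`. It supplies the cores. -/
theorem Convex.exists_isCompact_convex_between {E : Type*} [NormedAddCommGroup E] [NormedSpace ℝ E]
    [FiniteDimensional ℝ E] {K U : Set E} (hU : Convex ℝ U) (hK : IsCompact K) (hUo : IsOpen U)
    (hKU : K ⊆ U) : ∃ c, IsCompact c ∧ Convex ℝ c ∧ K ⊆ c ∧ c ⊆ U := by
  classical
  have h1 : ∀ x ∈ K, ∃ u : Finset E, convexHull ℝ (u : Set E) ∈ 𝓝 x ∧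
      convexHull ℝ (u : Set E) ⊆ U := by
    intro x hx
    obtain ⟨u, hu1, hu2⟩ := (convex_singleton (𝕜 := ℝ)
      x).exists_subset_interior_convexHull_finset_of_isCompact isCompact_singleton
      (by simpa using hUo.mem_nhds (hKU hx))
    exact ⟨u, mem_interior_iff_mem_nhds.1 (singleton_subset_iff.1 hu1), hu2⟩
  choose! u hu1 hu2 using h1
  obtain ⟨t, ht, hKt⟩ := hK.elim_nhds_subcover _ hu1
  have hfin : (⋃ x ∈ t, (u x : Set E)).Finite := t.finite_toSet.biUnion fun x _ => (u x).finite_toSet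
  refine ⟨convexHull ℝ (⋃ x ∈ t, (u x : Set E)), hfin.isCompact_convexHull ℝ,
    convex_convexHull ℝ _, hKt.trans (iUnion₂_subset fun x hx => convexHull_mono
      (subset_biUnion_of_mem (u := fun x => (u x : Set E)) hx)), convexHull_min ?_ hU⟩
  exact iUnion₂_subset fun x hx => (subset_convexHull ℝ _).trans (hu2 x (ht x hx))

/-! ### Densities as measures, and cheap couplings with perturbed densities. -/

namespace SampleSpace

open scoped ENNReal

variable {d : ℕ} {X : SampleSpace d}

theorem aemeasurable_ofReal_cell {g : EuclideanSpace ℝ (Fin d) → ℝ} (hg : ContinuousOn g X.cover) :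
    AEMeasurable (fun x => ENNReal.ofReal (g x)) (volume.restrict X.cell) :=
  (aestronglyMeasurable_cell hg).aemeasurable.ennreal_ofReal

namespace Density

variable (q : Density X)

theorem toMeasure_apply {s : Set (EuclideanSpace ℝ (Fin d))} (hs : MeasurableSet s) :
    q.toMeasure s = ∫⁻ x in s, ENNReal.ofReal (q x) ∂(volume.restrict X.cell) :=
  withDensity_apply _ hs

theorem toMeasure_absolutelyContinuous : q.toMeasure ≪ volume.restrict X.cell :=
  withDensity_absolutelyContinuous _ _

theorem toMeasure_compl_cell : q.toMeasure X.cellᶜ = 0 :=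
  q.toMeasure_absolutelyContinuous (by simp [Measure.restrict_apply X.measurableSet_cell.compl])

theorem ae_mem_cell : ∀ᵐ x ∂q.toMeasure, x ∈ X.cell := by
  have := measure_eq_zero_iff_ae_notMem.1 q.toMeasure_compl_cell
  simpa using this

theorem integral_toMeasure (h : EuclideanSpace ℝ (Fin d) → ℝ) :
    ∫ x, h x ∂q.toMeasure = X.integral fun x => h x * q x := by
  rw [toMeasure, integral_withDensity_eq_integral_toReal_smul₀
    (aemeasurable_ofReal_cell q.smooth.continuousOn) (Eventually.of_forall fun _ => by simp),
    integral]
  refine setIntegral_congr_fun X.measurableSet_cell fun x hx => ?_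
  simp only [smul_eq_mul]
  rw [ENNReal.toReal_ofReal (q.nonneg x (X.cell_subset_cover hx)), mul_comm]

instance : IsProbabilityMeasure q.toMeasure := by
  refine ⟨?_⟩
  rw [q.toMeasure_apply .univ, Measure.restrict_univ, ← ofReal_integral_eq_lintegral_ofReal
    (integrableOn_cell q.smooth.continuousOn)]
  · have := q.integral_eq_one
    rw [integral] at this
    rw [this, ENNReal.ofReal_one]
  · filter_upwards [ae_restrict_mem X.measurableSet_cell] with x hx
    exact q.nonneg x (X.cell_subset_cover hx)

theorem toMeasure_le_smul_volume : ∃ B : ℝ≥0∞, B ≠ ⊤ ∧ q.toMeasure ≤ B • volume := by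
  obtain ⟨C, hC⟩ := q.smooth.exists_bound_cover
  refine ⟨ENNReal.ofReal C, ENNReal.ofReal_ne_top, Measure.le_iff.2 fun s hs => ?_⟩
  rw [q.toMeasure_apply hs, Measure.restrict_restrict hs, Measure.smul_apply, smul_eq_mul]
  calc ∫⁻ x in s ∩ X.cell, ENNReal.ofReal (q x) ≤ ∫⁻ _ in s ∩ X.cell, ENNReal.ofReal C := by
        refine setLIntegral_mono' (hs.inter X.measurableSet_cell) fun x hx => ?_
        exact ENNReal.ofReal_le_ofReal ((le_abs_self _).trans (hC x (X.cell_subset_cover hx.2)))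
    _ = ENNReal.ofReal C * volume (s ∩ X.cell) := setLIntegral_const _ _
    _ ≤ _ := by gcongr; exact inter_subset_left

theorem toMeasure_compl_interior_cell : q.toMeasure (interior X.cell)ᶜ = 0 :=
  q.toMeasure_absolutelyContinuous (mem_ae_iff.1 X.ae_mem_interior_cell)

/-- A density which is positive in the interior has convex cores of almost full mass on which it
is bounded below. -/
theorem exists_core (hq : ∀ x ∈ interior X.cover, 0 < q x) {ε : ℝ≥0∞} (hε : ε ≠ 0) :
    ∃ c, MeasurableSet c ∧ Convex ℝ c ∧ q.toMeasure cᶜ ≤ ε ∧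
      ∃ b : ℝ≥0∞, b ≠ ⊤ ∧ volume.restrict c ≤ b • q.toMeasure := by
  obtain ⟨K, hKs, hK, hKε⟩ := (isOpen_interior (s := X.cell)).measurableSet.exists_isCompact_sdiff_lt
    (μ := q.toMeasure) (measure_ne_top _ _) hε
  obtain ⟨c, hc, hconv, hKc, hcs⟩ :=
    X.convex_cell.interior.exists_isCompact_convex_between hK isOpen_interior hKs
  have hcell : c ⊆ X.cell := hcs.trans interior_subset
  refine ⟨c, hc.measurableSet, hconv, ?_, ?_⟩
  · have h1 : (c)ᶜ ⊆ (interior X.cell)ᶜ ∪ (interior X.cell \ K) := by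
      intro x hx
      by_cases h : x ∈ interior X.cell
      · exact Or.inr ⟨h, fun h2 => hx (hKc h2)⟩
      · exact Or.inl h
    refine (measure_mono h1).trans ((measure_union_le _ _).trans ?_)
    rw [q.toMeasure_compl_interior_cell, zero_add]
    exact hKε.le
  · obtain ⟨a, ha, haq⟩ := hc.exists_forall_le' (a := 0)
      (q.smooth.continuousOn.mono (hcell.trans X.cell_subset_cover))
      fun x hx => hq x (cell_subset_interior_cover (hcs hx))
    have ha0 : ENNReal.ofReal a ≠ 0 := (ENNReal.ofReal_pos.2 ha).ne'
    refine ⟨(ENNReal.ofReal a)⁻¹, ENNReal.inv_ne_top.2 ha0, Measure.le_iff.2 fun s hs => ?_⟩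
    rw [Measure.restrict_apply hs, Measure.smul_apply, smul_eq_mul, ← ENNReal.div_eq_inv_mul,
      ENNReal.le_div_iff_mul_le (Or.inl ha0) (Or.inl ENNReal.ofReal_ne_top), mul_comm]
    have hsc := hs.inter hc.measurableSet
    refine le_trans ?_ (measure_mono (inter_subset_left (t := c)))
    rw [q.toMeasure_apply hsc, Measure.restrict_restrict hsc,
      inter_eq_left.2 (inter_subset_right.trans hcell), ← setLIntegral_const]
    exact setLIntegral_mono' hsc fun x hx => ENNReal.ofReal_le_ofReal (haq x hx.2)

end Density

/-- A perturbation `q + t σ` can be reached from `q` at a quadratic cost which is `o(t)`. -/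
theorem exists_coupling_add_smul {q : Density X} (hq : ∀ x ∈ interior X.cover, 0 < q x)
    {σ : EuclideanSpace ℝ (Fin d) → ℝ} (hσ : X.IsSmooth σ) (hσ0 : X.integral σ = 0) {C : ℝ}
    (hC : ∀ x ∈ X.cover, |σ x| ≤ C * q x) {ε : ℝ} (hε : 0 < ε) :
    ∃ δ : ℝ, 0 < δ ∧ ∀ t : ℝ, 0 ≤ t → t ≤ δ → ∀ r : Density X,
      (∀ x ∈ X.cover, r x = q x + t * σ x) →
      ∃ γ : Measure (EuclideanSpace ℝ (Fin d) × EuclideanSpace ℝ (Fin d)),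
        γ.map Prod.fst = q.toMeasure ∧ γ.map Prod.snd = r.toMeasure ∧
          ∫⁻ z, ‖z.1 - z.2‖ₑ ^ 2 ∂γ ≤ ENNReal.ofReal (t * ε) := by
  have hbound : ∀ τ : EuclideanSpace ℝ (Fin d) → ℝ, (∀ x ∈ X.cover, τ x ≤ C * q x) →
      (volume.restrict X.cell).withDensity (fun x => ENNReal.ofReal (τ x)) ≤
        ENNReal.ofReal C • q.toMeasure := by
    intro τ hτ
    rw [Density.toMeasure, ← withDensity_smul' _ _ ENNReal.ofReal_ne_top]
    refine withDensity_mono ?_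
    filter_upwards [ae_restrict_mem X.measurableSet_cell] with x hx
    have hx' := X.cell_subset_cover hx
    rw [Pi.smul_apply, smul_eq_mul, ← ENNReal.ofReal_mul' (q.nonneg x hx')]
    exact ENNReal.ofReal_le_ofReal (hτ x hx')
  set μ := (volume.restrict X.cell).withDensity fun x => ENNReal.ofReal (-σ x) with hμdef
  set ν := (volume.restrict X.cell).withDensity fun x => ENNReal.ofReal (σ x) with hνdef
  have hμ : μ ≤ ENNReal.ofReal C • q.toMeasure :=
    hbound _ fun x hx => (neg_le_abs _).trans (hC x hx)
  have hν : ν ≤ ENNReal.ofReal C • q.toMeasure :=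
    hbound _ fun x hx => (le_abs_self _).trans (hC x hx)
  have hfin : ∀ s, (ENNReal.ofReal C • q.toMeasure) s < ⊤ := fun s => by
    rw [Measure.smul_apply, smul_eq_mul]
    exact ENNReal.mul_lt_top ENNReal.ofReal_lt_top (measure_lt_top _ _)
  have : IsFiniteMeasure μ := ⟨(hμ univ).trans_lt (hfin _)⟩
  have : IsFiniteMeasure ν := ⟨(hν univ).trans_lt (hfin _)⟩
  have hmass : μ univ = ν univ := by
    have h1 := integral_eq_lintegral_pos_part_sub_lintegral_neg_part
      (integrableOn_cell hσ.continuousOn)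
    rw [integral] at hσ0
    rw [hσ0] at h1
    rw [← ENNReal.toReal_eq_toReal_iff' (measure_ne_top _ _) (measure_ne_top _ _), hμdef, hνdef,
      withDensity_apply _ .univ, withDensity_apply _ .univ, Measure.restrict_univ]
    linarith
  obtain ⟨B, hB, hQB⟩ := q.toMeasure_le_smul_volume
  obtain ⟨m, C', hC', hm1, hm2, hmε⟩ := exists_short_transport (vol := volume)
    ENNReal.ofReal_ne_top hB hμ hν hQB hmass X.isBounded_cell q.toMeasure_compl_cell
    (fun ε hε => q.exists_core hq hε) (ENNReal.ofReal_pos.2 hε).ne'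
  -- This choice ensures `t C' ≤ 1`, so that `q` can supply the moved mass. Here `C'` depends on
  -- `ε`, which is why the cost is `o(t)` with no explicit rate.
  refine ⟨(C'.toReal + 1)⁻¹, by positivity, fun t ht htδ r hr => ?_⟩
  have htC : ENNReal.ofReal t * C' ≤ 1 := by
    rw [← ENNReal.ofReal_toReal hC', ← ENNReal.ofReal_mul ht, ENNReal.ofReal_le_one]
    have h1 : 0 ≤ C'.toReal := ENNReal.toReal_nonneg
    calc t * C'.toReal ≤ (C'.toReal + 1)⁻¹ * (C'.toReal + 1) := by gcongr; linarith
      _ = 1 := inv_mul_cancel₀ (by positivity)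
  have hQ' : r.toMeasure + ENNReal.ofReal t • μ = q.toMeasure + ENNReal.ofReal t • ν := by
    refine Measure.ext fun s hs => ?_
    have hmul : ∀ τ : EuclideanSpace ℝ (Fin d) → ℝ, ContinuousOn τ X.cover →
        ENNReal.ofReal t * ∫⁻ x in s, ENNReal.ofReal (τ x) ∂(volume.restrict X.cell) =
          ∫⁻ x in s, ENNReal.ofReal t * ENNReal.ofReal (τ x) ∂(volume.restrict X.cell) :=
      fun τ hτ => (lintegral_const_mul'' _ ((aemeasurable_ofReal_cell hτ).restrict)).symm
    rw [Measure.add_apply, Measure.add_apply, Measure.smul_apply, Measure.smul_apply,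
      smul_eq_mul, smul_eq_mul, r.toMeasure_apply hs, q.toMeasure_apply hs, hμdef, hνdef,
      withDensity_apply _ hs, withDensity_apply _ hs, hmul _ hσ.neg.continuousOn,
      hmul _ hσ.continuousOn, ← lintegral_add_left' (aemeasurable_ofReal_cell
        r.smooth.continuousOn).restrict, ← lintegral_add_left' (aemeasurable_ofReal_cell
        q.smooth.continuousOn).restrict]
    refine lintegral_congr_ae (ae_restrict_of_ae ?_)
    filter_upwards [ae_restrict_mem X.measurableSet_cell] with x hx
    have hx' := X.cell_subset_cover hx
    have hq0 := q.nonneg x hx'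
    have hr0 := r.nonneg x hx'
    rw [← ENNReal.ofReal_mul ht, ← ENNReal.ofReal_mul ht]
    rcases le_total 0 (σ x) with h | h
    · rw [ENNReal.ofReal_of_nonpos (p := t * -σ x) (by nlinarith), add_zero,
        ← ENNReal.ofReal_add hq0 (by positivity), hr x hx']
    · rw [ENNReal.ofReal_of_nonpos (p := t * σ x) (by nlinarith), add_zero,
        ← ENNReal.ofReal_add hr0 (by nlinarith), hr x hx']
      congr 1
      ring
  obtain ⟨γ, hγ1, hγ2, hγ3⟩ := exists_coupling_of_transport (Q' := r.toMeasure) hm1 hm2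
    (t := ENNReal.ofReal t) ENNReal.ofReal_ne_top htC hQ'
  refine ⟨γ, hγ1, hγ2, ?_⟩
  rw [hγ3, ENNReal.ofReal_mul ht]
  gcongr

end SampleSpace

/-! ### Taylor bounds, convexity and the transport map. -/

namespace SampleSpace

open scoped ENNReal

variable {d : ℕ} {X : SampleSpace d}

theorem hasFDerivWithinAt_norm_sq (x : EuclideanSpace ℝ (Fin d))
    (s : Set (EuclideanSpace ℝ (Fin d))) :
    HasFDerivWithinAt (fun y : EuclideanSpace ℝ (Fin d) => ‖y‖ ^ 2 / 2) (innerSL ℝ x) s x := by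
  have h := ((hasStrictFDerivAt_norm_sq x).hasFDerivAt.hasFDerivWithinAt (s := s)).const_mul
    ((2 : ℝ)⁻¹)
  have h2 : (fun y : EuclideanSpace ℝ (Fin d) => ‖y‖ ^ 2 / 2) = fun y => (2 : ℝ)⁻¹ * ‖y‖ ^ 2 := by
    ext y; ring
  rw [h2]
  refine h.congr_fderiv ?_
  ext y
  simp

/-- The first-order approximation of a smooth function, with a uniform quadratic error. -/
theorem IsSmooth.exists_taylor_bound {η : EuclideanSpace ℝ (Fin d) → ℝ} (hη : X.IsSmooth η) :
    ∃ C : ℝ, 0 ≤ C ∧ ∀ x ∈ X.cover, ∀ y ∈ X.cover,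
      |η y - η x - ⟪X.grad η x, y - x⟫| ≤ C * ‖y - x‖ ^ 2 := by
  obtain ⟨L, -, hL⟩ := exists_lipschitzOnWith_cover (v := X.grad η)
    (hη.grad_contDiffOn.of_le (by simp)) (fun x _ k hk => hη.grad_add_period hk)
  refine ⟨L, L.2, fun x hx y hy => ?_⟩
  have hseg : segment ℝ x y ⊆ X.cover := X.convex_cover.segment_subset hx hy
  have h := (convex_segment (𝕜 := ℝ) x y).norm_image_sub_le_of_norm_hasFDerivWithin_le'
    (f := η) (f' := fun z => fderivWithin ℝ η X.cover z) (φ := fderivWithin ℝ η X.cover x)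
    (C := L * ‖y - x‖)
    (fun z hz => ((hη.differentiableWithinAt (hseg hz)).hasFDerivWithinAt).mono hseg)
    (fun z hz => by
      have h1 := hL.dist_le_mul z (hseg hz) x hx
      have h2 : dist (X.grad η z) (X.grad η x) =
          ‖fderivWithin ℝ η X.cover z - fderivWithin ℝ η X.cover x‖ := by
        rw [dist_eq_norm, grad, gradientWithin, gradientWithin, ← map_sub,
          LinearIsometryEquiv.norm_map]
      rw [← h2]
      refine h1.trans ?_
      gcongr
      rw [dist_eq_norm]
      obtain ⟨s, hs, rfl⟩ := (segment_eq_image' ℝ x y) ▸ hz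
      simp only [add_sub_cancel_left, norm_smul, Real.norm_eq_abs]
      rw [abs_of_nonneg hs.1]
      exact mul_le_of_le_one_left (norm_nonneg _) hs.2)
    (left_mem_segment ℝ x y) (right_mem_segment ℝ x y)
  rw [inner_grad, ← Real.norm_eq_abs]
  refine h.trans_eq ?_
  ring

/-- Restrict to the segment from `x` to `y`: for a convex function of one variable the right
derivative at `0` is at most the slope over `[0, 1]`. The point `x` may lie on the boundary. -/
theorem _root_.ConvexOn.fderivWithin_le_sub {E : Type*} [NormedAddCommGroup E] [NormedSpace ℝ E]
    {s : Set E} {Φ : E → ℝ} (h : ConvexOn ℝ s Φ) {x y : E} (hx : x ∈ s) (hy : y ∈ s)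
    {Φ' : E →L[ℝ] ℝ} (hΦ : HasFDerivWithinAt Φ Φ' s x) : Φ' (y - x) ≤ Φ y - Φ x := by
  have hmaps : MapsTo (AffineMap.lineMap (k := ℝ) x y) (Icc (0 : ℝ) 1) s :=
    fun t ht => h.1.lineMap_mem hx hy ht
  have h1 : ConvexOn ℝ (Icc (0 : ℝ) 1) (Φ ∘ AffineMap.lineMap (k := ℝ) x y) :=
    (h.comp_affineMap (AffineMap.lineMap x y)).subset hmaps (convex_Icc 0 1)
  have h2 : HasDerivWithinAt (Φ ∘ AffineMap.lineMap (k := ℝ) x y) (Φ' (y - x)) (Icc (0 : ℝ) 1) 0 := by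
    refine HasFDerivWithinAt.comp_hasDerivWithinAt (t := s) 0 ?_
      AffineMap.hasDerivWithinAt_lineMap hmaps
    simpa using hΦ
  have h3 := h1.le_slope_of_hasDerivWithinAt (left_mem_Icc.2 zero_le_one)
    (right_mem_Icc.2 zero_le_one) one_pos h2
  simpa [slope_def_field] using h3

theorem setLIntegral_torus_eq {s : Set (EuclideanSpace ℝ (Fin d))} (hs : MeasurableSet s)
    (h : ∀ x ∈ s, ∀ k ∈ (torus : SampleSpace d).periods, x + k ∈ s → k = 0)
    (hcov : ∀ x, ∃ k ∈ (torus : SampleSpace d).periods, x + k ∈ s)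
    {H : EuclideanSpace ℝ (Fin d) → ℝ≥0∞}
    (hH : ∀ x, ∀ k ∈ (torus : SampleSpace d).periods, H (x + k) = H x) :
    ∫⁻ x in s, H x = ∫⁻ x in (torus : SampleSpace d).cell, H x := by
  have : Countable (Submodule.span ℤ
      (range (EuclideanSpace.basisFun (Fin d) ℝ).toBasis)).toAddSubgroup :=
    countable_span_basisFun
  rw [cell_torus]
  have h0 := ZSpan.isAddFundamentalDomain' (EuclideanSpace.basisFun (Fin d) ℝ).toBasis volume
  rw [periods_torus] at h hcov hH
  refine IsAddFundamentalDomain.setLIntegral_eq (G := (Submodule.span ℤ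
      (range (EuclideanSpace.basisFun (Fin d) ℝ).toBasis)).toAddSubgroup)
    (IsAddFundamentalDomain.mk' hs.nullMeasurableSet fun x => ?_) h0 H
    fun g x => ?_
  · obtain ⟨k, hk, hxk⟩ := hcov x
    refine ⟨⟨k, hk⟩, ?_, fun l hl => ?_⟩
    · change k + x ∈ s
      rwa [add_comm]
    · have hl' : (l : EuclideanSpace ℝ (Fin d)) + x ∈ s := hl
      have h1 := h _ hxk ((l : EuclideanSpace ℝ (Fin d)) - k) (sub_mem l.2 hk) (by
        rwa [add_add_sub_cancel, add_comm])
      exact Subtype.ext (sub_eq_zero.1 h1)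
  · change H (g + x) = H x
    rw [add_comm]
    exact hH x g g.2

section Transport

variable {p q : Density X} {Φ : EuclideanSpace ℝ (Fin d) → ℝ} (hΦ : X.IsTransportPotential q p Φ)

include hΦ

theorem IsTransportPotential.differentiableWithinAt {x : EuclideanSpace ℝ (Fin d)}
    (hx : x ∈ X.cover) : DifferentiableWithinAt ℝ Φ X.cover x := by
  have h := (hΦ.1.differentiableWithinAt hx).add
    (hasFDerivWithinAt_norm_sq x X.cover).differentiableWithinAt
  refine h.congr (fun y _ => ?_) ?_ <;> simp

theorem IsTransportPotential.grad_sub_eq {x : EuclideanSpace ℝ (Fin d)} (hx : x ∈ X.cover) :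
    X.grad (fun y => Φ y - ‖y‖ ^ 2 / 2) x = X.grad Φ x - x := by
  rw [grad_sub hx (hΦ.differentiableWithinAt hx)
    (hasFDerivWithinAt_norm_sq x X.cover).differentiableWithinAt]
  congr 1
  refine ext_inner_right ℝ fun w => ?_
  rw [inner_grad, (hasFDerivWithinAt_norm_sq x X.cover).fderivWithin (X.uniqueDiffOn_cover x hx)]
  simp

theorem IsTransportPotential.contDiffOn_grad : ContDiffOn ℝ ∞ (X.grad Φ) X.cover := by
  refine (hΦ.1.grad_contDiffOn.add contDiffOn_id).congr fun x hx => ?_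
  simp [hΦ.grad_sub_eq hx]

theorem IsTransportPotential.grad_add_period {x k : EuclideanSpace ℝ (Fin d)} (hx : x ∈ X.cover)
    (hk : k ∈ X.periods) : X.grad Φ (x + k) = X.grad Φ x + k := by
  have h := hΦ.1.grad_add_period (x := x) hk
  rw [hΦ.grad_sub_eq hx, hΦ.grad_sub_eq (X.add_mem_cover hx hk)] at h
  rw [← sub_eq_zero] at h ⊢
  rw [← h]
  abel

/-- On the torus `T` is bijective and commutes with periods, so it carries the unit cell to another
fundamental domain; periodic functions have the same integral over both. -/
theorem IsTransportPotential.lintegral_image_cell {H : EuclideanSpace ℝ (Fin d) → ℝ≥0∞}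
    (hH : ∀ x ∈ X.cover, ∀ k ∈ X.periods, H (x + k) = H x) :
    ∫⁻ x in X.grad Φ '' X.cell, H x = ∫⁻ x in X.cell, H x := by
  have hdiff := hΦ.contDiffOn_grad.differentiableOn (by simp)
  have hmeas : MeasurableSet (X.grad Φ '' X.cell) :=
    measurable_image_of_fderivWithin X.measurableSet_cell
      (fun x hx => ((hdiff x (X.cell_subset_cover hx)).hasFDerivWithinAt).mono X.cell_subset_cover)
      (hΦ.2.2.1.injOn.mono X.cell_subset_cover)
  cases X with
  | convexBody K _ _ _ =>
    have : grad (convexBody K _ _ _) Φ '' K = K := hΦ.2.2.1.image_eq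
    simp only [cell, this]
  | torus =>
    refine setLIntegral_torus_eq hmeas ?_ ?_ fun x k hk => hH x (mem_univ x) k hk
    · rintro _ ⟨x, hx, rfl⟩ k hk ⟨y, hy, hxy⟩
      rw [← hΦ.grad_add_period (mem_univ x) hk] at hxy
      have h3 : y = x + k := hΦ.2.2.1.injOn (mem_univ _) (mem_univ _) hxy
      subst h3
      exact torus.eq_of_mem_cell_of_add_mem_cell hx hk hy
    · intro x
      obtain ⟨y, -, rfl⟩ := hΦ.2.2.1.surjOn (mem_univ x)
      obtain ⟨R, -, hR⟩ := (torus : SampleSpace d).exists_reduction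
      obtain ⟨h1, k, hk, h2⟩ := hR y (mem_univ y)
      refine ⟨k, hk, y + k, h2 ▸ h1, hΦ.grad_add_period (mem_univ y) hk⟩

/-- The transport map, reduced to the unit cell, pushes `q` forward to `p`. -/
theorem IsTransportPotential.exists_map_eq :
    ∃ S : EuclideanSpace ℝ (Fin d) → EuclideanSpace ℝ (Fin d), Measurable S ∧
      (∀ x ∈ X.cell, S x ∈ X.cell ∧ ∃ k ∈ X.periods, S x = X.grad Φ x + k) ∧
      q.toMeasure.map S = p.toMeasure := by
  classical
  obtain ⟨R, hRm, hR⟩ := X.exists_reduction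
  have hTc : ContinuousOn (X.grad Φ) X.cell :=
    hΦ.contDiffOn_grad.continuousOn.mono X.cell_subset_cover
  have hT : Measurable (X.cell.piecewise (X.grad Φ) fun _ => 0) :=
    hTc.measurable_piecewise continuousOn_const X.measurableSet_cell
  have hmaps : ∀ x ∈ X.cell, X.grad Φ x ∈ X.cover :=
    fun x hx => hΦ.2.2.1.mapsTo (X.cell_subset_cover hx)
  have hRcell : ∀ x ∈ X.cell, R x = x := by
    intro x hx
    obtain ⟨h1, k, hk, h2⟩ := hR x (X.cell_subset_cover hx)
    rw [h2, X.eq_of_mem_cell_of_add_mem_cell hx hk (h2 ▸ h1), add_zero]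
  have hRper : ∀ x ∈ X.cover, ∀ k ∈ X.periods, R (x + k) = R x := by
    intro x hx k hk
    obtain ⟨h1, l, hl, h2⟩ := hR x hx
    obtain ⟨h3, m, hm, h4⟩ := hR (x + k) (X.add_mem_cover hx hk)
    have h5 : k + m + -l ∈ X.periods :=
      X.add_mem_periods (X.add_mem_periods hk hm) (X.neg_mem_periods hl)
    have h6 : R x + (k + m + -l) = R (x + k) := by rw [h2, h4]; abel
    have h7 := X.eq_of_mem_cell_of_add_mem_cell h1 h5 (h6 ▸ h3)
    rw [← h6, h7, add_zero]
  -- Outside the cell, a null set for `q`, the value `0` is arbitrary and only secures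
  -- measurability.
  refine ⟨R ∘ X.cell.piecewise (X.grad Φ) fun _ => 0, hRm.comp hT, fun x hx => ?_, ?_⟩
  · rw [Function.comp_apply, piecewise_eq_of_mem _ _ _ hx]
    exact hR _ (hmaps x hx)
  refine Measure.ext fun A hA => ?_
  have hdiff := hΦ.contDiffOn_grad.differentiableOn (by simp)
  set H : EuclideanSpace ℝ (Fin d) → ℝ≥0∞ :=
    fun y => (R ⁻¹' A).indicator (fun y => ENNReal.ofReal (p y)) y with hHdef
  have hH : ∀ x ∈ X.cover, ∀ k ∈ X.periods, H (x + k) = H x := by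
    intro x hx k hk
    simp only [hHdef, indicator, mem_preimage, hRper x hx k hk, p.smooth.2 x hx k hk]
  have h1 := hΦ.lintegral_image_cell hH
  rw [lintegral_image_eq_lintegral_abs_det_fderiv_mul volume X.measurableSet_cell
    (fun x hx => ((hdiff x (X.cell_subset_cover hx)).hasFDerivWithinAt).mono X.cell_subset_cover)
    (hΦ.2.2.1.injOn.mono X.cell_subset_cover)] at h1
  have hpre : MeasurableSet ((R ∘ X.cell.piecewise (X.grad Φ) fun _ => 0) ⁻¹' A) :=
    (hRm.comp hT) hA
  rw [Measure.map_apply (hRm.comp hT) hA, q.toMeasure_apply hpre, p.toMeasure_apply hA,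
    ← lintegral_indicator hpre, ← lintegral_indicator hA]
  have h2 : ∫⁻ x in X.cell, A.indicator (fun y => ENNReal.ofReal (p y)) x = ∫⁻ x in X.cell, H x :=
    setLIntegral_congr_fun X.measurableSet_cell fun x hx => by
      simp only [hHdef, indicator, mem_preimage, hRcell x hx]
  rw [h2, ← h1]
  refine setLIntegral_congr_fun X.measurableSet_cell fun x hx => ?_
  have hx' := X.cell_subset_cover hx
  simp only [hHdef, indicator, mem_preimage, Function.comp_apply, piecewise_eq_of_mem _ _ _ hx]
  split_ifs with hmem
  · have h3 := hΦ.2.2.2 x hx'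
    rw [← ENNReal.ofReal_mul (abs_nonneg _)]
    congr 1
    -- Nonnegativity of `p` and `q` lets absolute values be taken in the Jacobian equation, so the
    -- sign of the determinant plays no role.
    rw [← abs_of_nonneg (q.nonneg x hx'), ← h3, abs_mul, abs_of_nonneg (p.nonneg _ (hmaps x hx)),
      mul_comm]
  · rw [mul_zero]

end Transport

end SampleSpace

/-! ### Kantorovich duality and the first variation of the squared distance. -/

namespace SampleSpace

open scoped ENNReal

variable {d : ℕ} {X : SampleSpace d}

theorem bddBelow_sqDist (x y : EuclideanSpace ℝ (Fin d)) :
    BddBelow (range fun k : X.periods => ‖x - y - k‖ ^ 2) :=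
  ⟨0, by rintro _ ⟨k, rfl⟩; positivity⟩

theorem sqDist_nonneg (x y : EuclideanSpace ℝ (Fin d)) : 0 ≤ X.sqDist x y :=
  Real.iInf_nonneg fun _ => by positivity

theorem sqDist_le {x y k : EuclideanSpace ℝ (Fin d)} (hk : k ∈ X.periods) :
    X.sqDist x y ≤ ‖x - y - k‖ ^ 2 := ciInf_le (bddBelow_sqDist x y) (⟨k, hk⟩ : X.periods)

theorem measurable_sqDist : Measurable fun z : EuclideanSpace ℝ (Fin d) × EuclideanSpace ℝ (Fin d) =>
    X.sqDist z.1 z.2 := by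
  refine Measurable.iInf fun k => ?_
  fun_prop

/-- The `c`-transform of `η`, for the quadratic cost. -/
noncomputable def cTransform (X : SampleSpace d) (η : EuclideanSpace ℝ (Fin d) → ℝ)
    (y : EuclideanSpace ℝ (Fin d)) : ℝ :=
  ⨅ x : X.cover, (‖(x : EuclideanSpace ℝ (Fin d)) - y‖ ^ 2 - η x)

section cTransform

variable {η : EuclideanSpace ℝ (Fin d) → ℝ} (hη : X.IsSmooth η)

include hη

theorem bddBelow_cTransform (y : EuclideanSpace ℝ (Fin d)) :
    BddBelow (range fun x : X.cover => ‖(x : EuclideanSpace ℝ (Fin d)) - y‖ ^ 2 - η x) := by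
  obtain ⟨C, hC⟩ := hη.exists_bound_cover
  refine ⟨-C, ?_⟩
  rintro _ ⟨x, rfl⟩
  have := (le_abs_self _).trans (hC x x.2)
  have : 0 ≤ ‖(x : EuclideanSpace ℝ (Fin d)) - y‖ ^ 2 := by positivity
  simp only
  linarith

theorem cTransform_le {x : EuclideanSpace ℝ (Fin d)} (hx : x ∈ X.cover)
    (y : EuclideanSpace ℝ (Fin d)) : X.cTransform η y ≤ ‖x - y‖ ^ 2 - η x :=
  ciInf_le (bddBelow_cTransform hη y) (⟨x, hx⟩ : X.cover)

/-- The infimum runs over the whole cover and `η` is periodic, so the Euclidean transform also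
bounds the cost after any shift by a period. -/
theorem cTransform_add_le_sqDist {x : EuclideanSpace ℝ (Fin d)} (hx : x ∈ X.cover)
    (y : EuclideanSpace ℝ (Fin d)) : X.cTransform η y + η x ≤ X.sqDist y x := by
  refine le_ciInf fun k => ?_
  have h := cTransform_le hη (X.add_mem_cover hx k.2) y
  rw [hη.2 x hx k k.2, norm_sub_rev] at h
  rw [sub_sub]
  linarith

theorem cTransform_add_period (y : EuclideanSpace ℝ (Fin d)) {k : EuclideanSpace ℝ (Fin d)}
    (hk : k ∈ X.periods) : X.cTransform η (y + k) = X.cTransform η y := by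
  have : Nonempty X.cover := X.nonempty_cover.to_subtype
  have key : ∀ y, ∀ k ∈ X.periods, X.cTransform η (y + k) ≤ X.cTransform η y := by
    intro y k hk
    refine le_ciInf fun x => ?_
    have h := cTransform_le hη (X.add_mem_cover x.2 hk) (y + k)
    rwa [hη.2 x x.2 k hk, add_sub_add_right_eq_sub] at h
  refine le_antisymm (key y k hk) ?_
  have := key (y + k) (-k) (X.neg_mem_periods hk)
  rwa [add_neg_cancel_right] at this

theorem measurable_cTransform : Measurable (X.cTransform η) :=
  (upperSemicontinuous_ciInf (bddBelow_cTransform hη) fun x => by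
    refine Continuous.upperSemicontinuous ?_
    fun_prop).measurable

theorem exists_bound_cTransform : ∃ C, ∀ y ∈ X.cell, |X.cTransform η y| ≤ C := by
  have : Nonempty X.cover := X.nonempty_cover.to_subtype
  obtain ⟨C, hC⟩ := hη.exists_bound_cover
  obtain ⟨x₀, hx₀⟩ := X.nonempty_cover
  obtain ⟨D, hD⟩ := X.isBounded_cell.exists_norm_le
  have hC0 : 0 ≤ C := (abs_nonneg _).trans (hC x₀ hx₀)
  refine ⟨(‖x₀‖ + D) ^ 2 + C, fun y hy => abs_le.2 ⟨?_, ?_⟩⟩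
  · refine le_ciInf fun x => ?_
    have h1 := (le_abs_self _).trans (hC x x.2)
    have h2 : 0 ≤ ‖(x : EuclideanSpace ℝ (Fin d)) - y‖ ^ 2 := by positivity
    have h3 : 0 ≤ (‖x₀‖ + D) ^ 2 := by positivity
    linarith
  · refine (cTransform_le hη hx₀ y).trans ?_
    have h1 := (neg_le_abs _).trans (hC x₀ hx₀)
    have h2 : ‖x₀ - y‖ ≤ ‖x₀‖ + D := (norm_sub_le _ _).trans (by gcongr; exact hD y hy)
    have h3 : ‖x₀ - y‖ ^ 2 ≤ (‖x₀‖ + D) ^ 2 := by gcongr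
    linarith

end cTransform

theorem wassersteinDist_sq (p r : Density X) : X.wassersteinDist p r ^ 2 =
    sInf {c : ℝ | ∃ π : Measure (EuclideanSpace ℝ (Fin d) × EuclideanSpace ℝ (Fin d)),
      π.map Prod.fst = p.toMeasure ∧ π.map Prod.snd = r.toMeasure ∧
        c = ∫ z, X.sqDist z.1 z.2 ∂π} := by
  refine Real.sq_sqrt (Real.sInf_nonneg ?_)
  rintro _ ⟨π, -, -, rfl⟩
  exact integral_nonneg fun z => sqDist_nonneg _ _

theorem wassersteinDist_sq_le {p r : Density X}
    {π : Measure (EuclideanSpace ℝ (Fin d) × EuclideanSpace ℝ (Fin d))}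
    (h1 : π.map Prod.fst = p.toMeasure) (h2 : π.map Prod.snd = r.toMeasure) :
    X.wassersteinDist p r ^ 2 ≤ ∫ z, X.sqDist z.1 z.2 ∂π := by
  rw [wassersteinDist_sq]
  refine csInf_le ⟨0, ?_⟩ ⟨π, h1, h2, rfl⟩
  rintro _ ⟨π, -, -, rfl⟩
  exact integral_nonneg fun z => sqDist_nonneg _ _

section Coupling

variable {p r : Density X} {π : Measure (EuclideanSpace ℝ (Fin d) × EuclideanSpace ℝ (Fin d))}

theorem isProbabilityMeasure_of_fst (h1 : π.map Prod.fst = p.toMeasure) :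
    IsProbabilityMeasure π := by
  refine ⟨?_⟩
  rw [← preimage_univ (f := Prod.fst), ← Measure.map_apply measurable_fst .univ, h1, measure_univ]

theorem ae_fst_mem_cell (h1 : π.map Prod.fst = p.toMeasure) : ∀ᵐ z ∂π, z.1 ∈ X.cell := by
  have := p.ae_mem_cell
  rw [← h1] at this
  exact ae_of_ae_map measurable_fst.aemeasurable this

theorem ae_snd_mem_cell (h2 : π.map Prod.snd = r.toMeasure) : ∀ᵐ z ∂π, z.2 ∈ X.cell := by
  have := r.ae_mem_cell
  rw [← h2] at this
  exact ae_of_ae_map measurable_snd.aemeasurable this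

theorem Density.integrable_toMeasure_of_bound (p : Density X) {g : EuclideanSpace ℝ (Fin d) → ℝ}
    (hg : AEStronglyMeasurable g (volume.restrict X.cell)) {C : ℝ} (hC : ∀ x ∈ X.cell, |g x| ≤ C) :
    Integrable g p.toMeasure :=
  Integrable.of_bound (hg.mono_ac p.toMeasure_absolutelyContinuous) C (by
    filter_upwards [p.ae_mem_cell] with x hx using hC x hx)

theorem Density.integrable_toMeasure (p : Density X) {g : EuclideanSpace ℝ (Fin d) → ℝ}
    (hg : ContinuousOn g X.cover) : Integrable g p.toMeasure := by
  obtain ⟨C, hC⟩ := IsSmooth.exists_bound hg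
  exact p.integrable_toMeasure_of_bound (aestronglyMeasurable_cell hg) hC

theorem integrable_fst (h1 : π.map Prod.fst = p.toMeasure) {g : EuclideanSpace ℝ (Fin d) → ℝ}
    (hg : Integrable g p.toMeasure) : Integrable (fun z => g z.1) π :=
  (h1 ▸ hg : Integrable g (π.map Prod.fst)).comp_measurable measurable_fst

theorem integrable_snd (h2 : π.map Prod.snd = r.toMeasure) {g : EuclideanSpace ℝ (Fin d) → ℝ}
    (hg : Integrable g r.toMeasure) : Integrable (fun z => g z.2) π :=
  (h2 ▸ hg : Integrable g (π.map Prod.snd)).comp_measurable measurable_snd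

theorem integral_fst (h1 : π.map Prod.fst = p.toMeasure) {g : EuclideanSpace ℝ (Fin d) → ℝ}
    (hg : Integrable g p.toMeasure) : ∫ z, g z.1 ∂π = ∫ x, g x ∂p.toMeasure := by
  rw [← h1] at hg ⊢
  exact (integral_map measurable_fst.aemeasurable hg.1).symm

theorem integral_snd (h2 : π.map Prod.snd = r.toMeasure) {g : EuclideanSpace ℝ (Fin d) → ℝ}
    (hg : Integrable g r.toMeasure) : ∫ z, g z.2 ∂π = ∫ x, g x ∂r.toMeasure := by
  rw [← h2] at hg ⊢
  exact (integral_map measurable_snd.aemeasurable hg.1).symm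

theorem exists_diam_bound (X : SampleSpace d) :
    ∃ D, ∀ x ∈ X.cell, ∀ y ∈ X.cell, ‖x - y‖ ≤ D := by
  obtain ⟨D, hD⟩ := Metric.isBounded_iff.1 X.isBounded_cell
  exact ⟨D, fun x hx y hy => by rw [← dist_eq_norm]; exact hD hx hy⟩

theorem integrable_sqDist (h1 : π.map Prod.fst = p.toMeasure) (h2 : π.map Prod.snd = r.toMeasure) :
    Integrable (fun z => X.sqDist z.1 z.2) π := by
  have := isProbabilityMeasure_of_fst h1
  obtain ⟨D, hD⟩ := exists_diam_bound X
  refine Integrable.of_bound measurable_sqDist.aestronglyMeasurable (D ^ 2) ?_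
  filter_upwards [ae_fst_mem_cell h1, ae_snd_mem_cell h2] with z hz1 hz2
  rw [Real.norm_eq_abs, abs_of_nonneg (sqDist_nonneg _ _)]
  refine (sqDist_le X.zero_mem_periods).trans ?_
  rw [sub_zero]
  gcongr
  exact hD _ hz1 _ hz2

theorem integrable_norm_sub_sq (h1 : π.map Prod.fst = p.toMeasure)
    (h2 : π.map Prod.snd = r.toMeasure) : Integrable (fun z => ‖z.1 - z.2‖ ^ 2) π := by
  have := isProbabilityMeasure_of_fst h1
  obtain ⟨D, hD⟩ := exists_diam_bound X
  refine Integrable.of_bound (by fun_prop) (D ^ 2) ?_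
  filter_upwards [ae_fst_mem_cell h1, ae_snd_mem_cell h2] with z hz1 hz2
  rw [Real.norm_eq_abs, abs_of_nonneg (by positivity)]
  gcongr
  exact hD _ hz1 _ hz2

/-- The easy half of Kantorovich duality. -/
theorem integral_cTransform_add_le {η : EuclideanSpace ℝ (Fin d) → ℝ} (hη : X.IsSmooth η)
    (p r : Density X) :
    ∫ y, X.cTransform η y ∂p.toMeasure + ∫ x, η x ∂r.toMeasure ≤ X.wassersteinDist p r ^ 2 := by
  rw [wassersteinDist_sq]
  -- The product coupling shows that the set of costs is nonempty; the real infimum of the empty set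
  -- would be `0`.
  refine le_csInf ⟨_, p.toMeasure.prod r.toMeasure, ?_, ?_, rfl⟩ ?_
  · rw [Measure.map_fst_prod, measure_univ, one_smul]
  · rw [Measure.map_snd_prod, measure_univ, one_smul]
  rintro _ ⟨π, h1, h2, rfl⟩
  obtain ⟨C, hC⟩ := exists_bound_cTransform hη
  have hi1 := p.integrable_toMeasure_of_bound (measurable_cTransform hη).aestronglyMeasurable hC
  have hi2 := r.integrable_toMeasure hη.continuousOn
  rw [← integral_fst h1 hi1, ← integral_snd h2 hi2,
    ← integral_add (integrable_fst h1 hi1) (integrable_snd h2 hi2)]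
  refine integral_mono_ae ((integrable_fst h1 hi1).add (integrable_snd h2 hi2))
    (integrable_sqDist h1 h2) ?_
  filter_upwards [ae_snd_mem_cell h2] with z hz
  exact cTransform_add_le_sqDist hη (X.cell_subset_cover hz) _

end Coupling

section Transport

variable {p q : Density X} {Φ : EuclideanSpace ℝ (Fin d) → ℝ} (hΦ : X.IsTransportPotential q p Φ)

include hΦ

theorem IsTransportPotential.isSmooth_norm_sq_sub : X.IsSmooth fun x => ‖x‖ ^ 2 - 2 * Φ x :=
  (hΦ.1.const_mul (-2)).congr fun x _ => by ring

theorem IsTransportPotential.grad_norm_sq_sub {x : EuclideanSpace ℝ (Fin d)} (hx : x ∈ X.cover) :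
    X.grad (fun x => ‖x‖ ^ 2 - 2 * Φ x) x = (2 : ℝ) • (x - X.grad Φ x) := by
  have h : (fun x => ‖x‖ ^ 2 - 2 * Φ x) = fun x => (-2 : ℝ) • (Φ x - ‖x‖ ^ 2 / 2) := by
    ext x
    simp only [smul_eq_mul]
    ring
  have h2 := hΦ.grad_sub_eq hx
  rw [h]
  simp only [grad, gradientWithin] at h2 ⊢
  rw [fderivWithin_fun_const_smul (X.uniqueDiffOn_cover x hx) (hΦ.1.differentiableWithinAt hx), map_smul, h2]
  module

/-- Expanding the square, the function to be minimised is `‖T x‖² + 2(Φ y - ⟪y, T x⟫)`, and by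
convexity its minimum is attained at `y = x`. -/
theorem IsTransportPotential.cTransform_grad {x : EuclideanSpace ℝ (Fin d)} (hx : x ∈ X.cover) :
    X.cTransform (fun x => ‖x‖ ^ 2 - 2 * Φ x) (X.grad Φ x) =
      ‖x - X.grad Φ x‖ ^ 2 - (‖x‖ ^ 2 - 2 * Φ x) := by
  have : Nonempty X.cover := X.nonempty_cover.to_subtype
  refine le_antisymm (cTransform_le hΦ.isSmooth_norm_sq_sub hx _) (le_ciInf fun y => ?_)
  have h := hΦ.2.1.convexOn.fderivWithin_le_sub hx y.2
    (hΦ.differentiableWithinAt hx).hasFDerivWithinAt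
  rw [← inner_grad, inner_sub_right, real_inner_comm (y : EuclideanSpace ℝ (Fin d)),
    real_inner_comm x] at h
  rw [norm_sub_sq_real, norm_sub_sq_real]
  linarith

theorem IsTransportPotential.integral_cTransform :
    ∫ y, X.cTransform (fun x => ‖x‖ ^ 2 - 2 * Φ x) y ∂p.toMeasure =
      ∫ x, (‖x - X.grad Φ x‖ ^ 2 - (‖x‖ ^ 2 - 2 * Φ x)) ∂q.toMeasure := by
  obtain ⟨S, hS, hST, hSp⟩ := hΦ.exists_map_eq
  rw [← hSp, integral_map hS.aemeasurable
    (measurable_cTransform hΦ.isSmooth_norm_sq_sub).aestronglyMeasurable]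
  refine integral_congr_ae ?_
  filter_upwards [q.ae_mem_cell] with x hx
  obtain ⟨-, k, hk, h⟩ := hST x hx
  rw [h, cTransform_add_period hΦ.isSmooth_norm_sq_sub _ hk,
    hΦ.cTransform_grad (X.cell_subset_cover hx)]

/-- Applying the transport map to the first coordinate of `γ` couples `p` with `r`. In `‖T x - y‖²`
the part linear in `y - x` is the first-order part of `η y - η x`, so only quadratic errors remain:
`1` from the square and `K` from Taylor's formula. -/
theorem IsTransportPotential.exists_wassersteinDist_sq_le :
    ∃ C : ℝ, 0 ≤ C ∧ ∀ r : Density X,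
      ∀ γ : Measure (EuclideanSpace ℝ (Fin d) × EuclideanSpace ℝ (Fin d)),
      γ.map Prod.fst = q.toMeasure → γ.map Prod.snd = r.toMeasure →
      X.wassersteinDist p r ^ 2 ≤
        ∫ x, (‖x - X.grad Φ x‖ ^ 2 - (‖x‖ ^ 2 - 2 * Φ x)) ∂q.toMeasure +
          ∫ x, (‖x‖ ^ 2 - 2 * Φ x) ∂r.toMeasure + C * ∫ z, ‖z.1 - z.2‖ ^ 2 ∂γ := by
  obtain ⟨S, hS, hST, hSp⟩ := hΦ.exists_map_eq
  have hη := hΦ.isSmooth_norm_sq_sub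
  obtain ⟨K, hK, hKη⟩ := hη.exists_taylor_bound
  refine ⟨1 + K, by positivity, fun r γ h1 h2 => ?_⟩
  have hSm : Measurable fun z : EuclideanSpace ℝ (Fin d) × EuclideanSpace ℝ (Fin d) =>
      (S z.1, z.2) := (hS.comp measurable_fst).prodMk measurable_snd
  have hπ1 : (γ.map fun z => (S z.1, z.2)).map Prod.fst = p.toMeasure := by
    rw [Measure.map_map measurable_fst hSm, ← hSp, ← h1, Measure.map_map hS measurable_fst]
    rfl
  have hπ2 : (γ.map fun z => (S z.1, z.2)).map Prod.snd = r.toMeasure := by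
    rw [Measure.map_map measurable_snd hSm, ← h2]
    rfl
  refine (wassersteinDist_sq_le hπ1 hπ2).trans ?_
  have hi := integrable_sqDist hπ1 hπ2
  rw [integral_map hSm.aemeasurable hi.1]
  have hc1 : ContinuousOn (fun x => ‖x - X.grad Φ x‖ ^ 2 - (‖x‖ ^ 2 - 2 * Φ x)) X.cover :=
    ((continuousOn_id.sub hΦ.contDiffOn_grad.continuousOn).norm.pow 2).sub hη.continuousOn
  have hi1 := integrable_fst h1 (q.integrable_toMeasure hc1)
  have hi2 := integrable_snd h2 (r.integrable_toMeasure hη.continuousOn)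
  have hi3 := (integrable_norm_sub_sq h1 h2).const_mul (1 + K)
  have hi12 : Integrable (fun z => ‖z.1 - X.grad Φ z.1‖ ^ 2 - (‖z.1‖ ^ 2 - 2 * Φ z.1) +
      (‖z.2‖ ^ 2 - 2 * Φ z.2)) γ := hi1.add hi2
  rw [← integral_fst h1 (q.integrable_toMeasure hc1),
    ← integral_snd h2 (r.integrable_toMeasure hη.continuousOn), ← integral_const_mul,
    ← integral_add hi1 hi2, ← integral_add hi12 hi3]
  refine integral_mono_ae (hi.comp_measurable hSm) (hi12.add hi3) ?_
  filter_upwards [ae_fst_mem_cell h1, ae_snd_mem_cell h2] with z hz1 hz2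
  obtain ⟨-, k, hk, h⟩ := hST z.1 hz1
  have hz1' := X.cell_subset_cover hz1
  have hz2' := X.cell_subset_cover hz2
  have hd := sqDist_le (x := S z.1) (y := z.2) hk
  have h3 : S z.1 - z.2 - k = (z.1 - z.2) - (z.1 - X.grad Φ z.1) := by rw [h]; abel
  rw [h3, norm_sub_sq_real] at hd
  have h4 := (abs_le.1 (hKη z.1 hz1' z.2 hz2')).1
  rw [hΦ.grad_norm_sq_sub hz1', real_inner_smul_left, ← neg_sub z.1 z.2, inner_neg_right,
    norm_neg, real_inner_comm] at h4
  linarith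

/-- The first variation of the squared Wasserstein distance. -/
theorem IsTransportPotential.isFirstVariation (hq : ∀ x ∈ interior X.cover, 0 < q x) :
    X.IsFirstVariation (fun r => X.wassersteinDist p r ^ 2) q fun x => ‖x‖ ^ 2 - 2 * Φ x := by
  have hη := hΦ.isSmooth_norm_sq_sub
  refine ⟨hη, fun σ hσ hσ0 c hc => ?_⟩
  set η : EuclideanSpace ℝ (Fin d) → ℝ := fun x => ‖x‖ ^ 2 - 2 * Φ x with hηdef
  set I := X.integral fun x => η x * σ x with hI
  set A := ∫ x, (‖x - X.grad Φ x‖ ^ 2 - η x) ∂q.toMeasure + ∫ x, η x ∂q.toMeasure with hA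
  obtain ⟨K, hK, hupper⟩ := hΦ.exists_wassersteinDist_sq_le
  obtain ⟨ρ, hρ, hcρ⟩ := Metric.eventually_nhds_iff_ball.1 hc
  have hint : ∀ t ∈ Metric.ball (0 : ℝ) ρ,
      ∫ x, η x ∂(c t).toMeasure = ∫ x, η x ∂q.toMeasure + t * I := by
    intro t ht
    have h1 : IntegrableOn (fun x => η x * q x) X.cell :=
      integrableOn_cell (hη.continuousOn.mul q.smooth.continuousOn)
    have h2 : IntegrableOn (fun x => η x * σ x) X.cell :=
      integrableOn_cell (hη.continuousOn.mul hσ.continuousOn)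
    rw [Density.integral_toMeasure, Density.integral_toMeasure, hI, integral, integral, integral,
      ← integral_const_mul, ← integral_add h1 (h2.const_mul t)]
    refine setIntegral_congr_fun X.measurableSet_cell fun x hx => ?_
    simp only [hcρ t ht x (X.cell_subset_cover hx)]
    ring
  have hlow : ∀ t ∈ Metric.ball (0 : ℝ) ρ, A + t * I ≤ X.wassersteinDist p (c t) ^ 2 := by
    intro t ht
    have h := integral_cTransform_add_le hη p (c t)
    rw [hΦ.integral_cTransform, hint t ht] at h
    linarith
  -- Both `q + (ρ/2) σ` and `q - (ρ/2) σ` are densities, hence nonnegative; this forces `σ` to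
  -- vanish wherever `q` does.
  have hbound : ∀ x ∈ X.cover, |σ x| ≤ (2 / ρ) * q x := by
    intro x hx
    have h1 := hcρ (ρ / 2) (by rw [Metric.mem_ball, Real.dist_eq, sub_zero, abs_of_pos] <;> linarith) x hx
    have h2 := hcρ (-(ρ / 2)) (by
      rw [Metric.mem_ball, Real.dist_eq, sub_zero, abs_neg, abs_of_pos] <;> linarith) x hx
    have h3 := (c (ρ / 2)).nonneg x hx
    have h4 := (c (-(ρ / 2))).nonneg x hx
    rw [h1] at h3
    rw [h2] at h4
    rw [div_mul_eq_mul_div, le_div_iff₀ hρ]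
    rcases abs_cases (σ x) with ⟨h5, -⟩ | ⟨h5, -⟩ <;> rw [h5] <;> linarith
  have hup : ∀ ε : ℝ, 0 < ε → ∀ᶠ t in 𝓝 (0 : ℝ),
      X.wassersteinDist p (c t) ^ 2 ≤ A + t * I + K * (|t| * ε) := by
    intro ε hε
    obtain ⟨δ₁, hδ₁, h1⟩ := exists_coupling_add_smul hq hσ hσ0 hbound hε
    -- Negative `t` is handled by writing `q + t σ = q + |t| (-σ)`.
    obtain ⟨δ₂, hδ₂, h2⟩ := exists_coupling_add_smul hq hσ.neg
      (by rw [integral, integral_neg, ← integral, hσ0, neg_zero])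
      (fun x hx => by rw [abs_neg]; exact hbound x hx) hε
    filter_upwards [Metric.ball_mem_nhds 0 hρ, Metric.ball_mem_nhds 0 hδ₁,
      Metric.ball_mem_nhds 0 hδ₂] with t ht ht1 ht2
    rw [Metric.mem_ball, Real.dist_eq, sub_zero] at ht1 ht2
    obtain ⟨γ, hγ1, hγ2, hγ⟩ : ∃ γ : Measure (EuclideanSpace ℝ (Fin d) × EuclideanSpace ℝ (Fin d)),
        γ.map Prod.fst = q.toMeasure ∧ γ.map Prod.snd = (c t).toMeasure ∧
          ∫⁻ z, ‖z.1 - z.2‖ₑ ^ 2 ∂γ ≤ ENNReal.ofReal (|t| * ε) := by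
      rcases le_total 0 t with h | h
      · rw [abs_of_nonneg h] at ht1 ⊢
        exact h1 t h ht1.le _ (hcρ t ht)
      · rw [abs_of_nonpos h] at ht2 ⊢
        exact h2 (-t) (by linarith) ht2.le _ fun x hx => by rw [hcρ t ht x hx]; ring
    have h3 := hupper (c t) γ hγ1 hγ2
    have h4 : ∫ z, ‖z.1 - z.2‖ ^ 2 ∂γ ≤ |t| * ε := by
      rw [integral_eq_lintegral_of_nonneg_ae (Eventually.of_forall fun z => by positivity)
        (integrable_norm_sub_sq hγ1 hγ2).1]
      refine ENNReal.toReal_le_of_le_ofReal (by positivity) (le_trans (le_of_eq ?_) hγ)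
      refine lintegral_congr fun z => ?_
      rw [ENNReal.ofReal_pow (norm_nonneg _), ofReal_norm]
    rw [hint t ht] at h3
    have h5 := mul_le_mul_of_nonneg_left h4 hK
    linarith
  -- At `t = 0` the two bounds coincide, which proves that `T` is optimal.
  have h0 : X.wassersteinDist p (c 0) ^ 2 = A := by
    have h1 := hlow 0 (Metric.mem_ball_self hρ)
    have h2 := (hup 1 one_pos).self_of_nhds
    rw [abs_zero] at h2
    linarith
  rw [hasDerivAt_iff_isLittleO_nhds_zero, Asymptotics.isLittleO_iff]
  intro ε hε
  -- Dividing by `K + 1` rather than `K` covers the case `K = 0`.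
  filter_upwards [hup (ε / (K + 1)) (by positivity), Metric.ball_mem_nhds 0 hρ] with t ht htρ
  have h1 := hlow t htρ
  simp only [zero_add, h0, smul_eq_mul, Real.norm_eq_abs]
  have h2 : K * (|t| * (ε / (K + 1))) ≤ ε * |t| := by
    have : K * (|t| * (ε / (K + 1))) = (K / (K + 1)) * (ε * |t|) := by field_simp
    rw [this]
    refine mul_le_of_le_one_left (by positivity) ?_
    rw [div_le_one (by positivity)]
    linarith
  rw [abs_of_nonneg (by linarith)]
  linarith

end Transport

end SampleSpace

/-! ### Uniqueness of the first variation and of the gradient field. -/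

namespace SampleSpace

variable {d : ℕ} {X : SampleSpace d}

theorem ae_eq_zero_of_integral_mul_eq_zero {q : Density X} (hq : ∀ x ∈ interior X.cover, 0 < q x)
    {g : EuclideanSpace ℝ (Fin d) → ℝ} (hg : ContinuousOn g X.cover) (hg0 : ∀ x ∈ X.cover, 0 ≤ g x)
    (h : X.integral (fun x => g x * q x) = 0) : ∀ᵐ x ∂(volume.restrict X.cell), g x = 0 := by
  rw [integral, integral_eq_zero_iff_of_nonneg_ae] at h
  · filter_upwards [h, X.ae_mem_interior_cell] with x hx hxi
    exact (mul_eq_zero.1 hx).resolve_right (hq x (cell_subset_interior_cover hxi)).ne'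
  · filter_upwards [ae_restrict_mem X.measurableSet_cell] with x hx
    have hx' := X.cell_subset_cover hx
    exact mul_nonneg (hg0 x hx') (q.nonneg x hx')
  · exact integrableOn_cell (hg.mul q.smooth.continuousOn)

/-- The relative perturbations of a density are admissible. -/
theorem Density.exists_curve (q : Density X) {u : EuclideanSpace ℝ (Fin d) → ℝ}
    (hu : X.IsSmooth u) (hu0 : X.integral (fun x => u x * q x) = 0) :
    ∃ c : ℝ → Density X, ∀ᶠ t in 𝓝 (0 : ℝ), ∀ x ∈ X.cover, c t x = q x + t * (u x * q x) := by
  classical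
  obtain ⟨M, hM⟩ := hu.exists_bound_cover
  -- For such `t` the factor `1 + t u` is nonnegative; for other `t` the value of the curve is
  -- irrelevant.
  let c : ℝ → Density X := fun t => if ht : |t| * M ≤ 1 then
    { toFun := fun x => q x + t * (u x * q x)
      smooth := q.smooth.add ((hu.mul q.smooth).const_mul t)
      nonneg := fun x hx => by
        have h1 : |t * u x| ≤ 1 := by
          rw [abs_mul]
          exact (mul_le_mul_of_nonneg_left (hM x hx) (abs_nonneg t)).trans ht
        have h2 := (abs_le.1 h1).1
        have h3 := q.nonneg x hx
        have h4 : q x + t * (u x * q x) = (1 + t * u x) * q x := by ring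
        rw [h4]
        exact mul_nonneg (by linarith) h3
      integral_eq_one := by
        have h1 : IntegrableOn (fun x => u x * q x) X.cell :=
          integrableOn_cell (hu.continuousOn.mul q.smooth.continuousOn)
        have h2 := q.integral_eq_one
        rw [integral] at hu0 h2 ⊢
        rw [integral_add (integrableOn_cell q.smooth.continuousOn) (h1.const_mul t),
          integral_const_mul, hu0, h2, mul_zero, add_zero]
      eq_zero_of_notMem := fun x hx => by simp [q.eq_zero_of_notMem x hx] }
    else q
  have hlim : Tendsto (fun t : ℝ => |t| * M) (𝓝 0) (𝓝 (|0| * M)) :=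
    (continuous_abs.mul continuous_const).tendsto 0
  rw [abs_zero, zero_mul] at hlim
  refine ⟨c, ?_⟩
  filter_upwards [hlim.eventually_le_const one_pos] with t ht x _
  simp only [c, dif_pos ht]

/-- The first variation is determined up to an additive constant. -/
theorem IsFirstVariation.ae_eq_add_const {q : Density X} (hq : ∀ x ∈ interior X.cover, 0 < q x)
    {G : Density X → ℝ} {η₁ η₂ : EuclideanSpace ℝ (Fin d) → ℝ} (h₁ : X.IsFirstVariation G q η₁)
    (h₂ : X.IsFirstVariation G q η₂) :
    ∃ a : ℝ, ∀ᵐ x ∂(volume.restrict X.cell), η₁ x = η₂ x + a := by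
  have hh := h₁.1.sub h₂.1
  -- The constant is the `q`-mean of the difference, so that `u q` has zero integral. Perturbing
  -- along `u q` itself gives `∫ u² q = 0`.
  set a := X.integral fun x => (η₁ x - η₂ x) * q x with ha
  refine ⟨a, ?_⟩
  set u : EuclideanSpace ℝ (Fin d) → ℝ := fun x => η₁ x - η₂ x - a with hu
  have hus : X.IsSmooth u := hh.sub (IsSmooth.const a)
  have hi : ∀ g : EuclideanSpace ℝ (Fin d) → ℝ, X.IsSmooth g →
      Integrable g (volume.restrict X.cell) := fun g hg => integrableOn_cell hg.continuousOn
  have hu0 : X.integral (fun x => u x * q x) = 0 := by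
    have h3 : X.integral (fun x => u x * q x) =
        ∫ x in X.cell, ((η₁ x - η₂ x) * q x - a * q x) := by
      simp only [integral, hu, sub_mul]
    have h4 := q.integral_eq_one
    rw [integral] at h4
    rw [h3, integral_sub (hi _ (hh.mul q.smooth)) (hi _ (q.smooth.const_mul a)),
      integral_const_mul, h4, ha, integral, mul_one, sub_self]
  obtain ⟨c, hc⟩ := q.exists_curve hus hu0
  have hσ := hus.mul q.smooth
  have h5 := (h₁.2 _ hσ hu0 c hc).unique (h₂.2 _ hσ hu0 c hc)
  have h6 : X.integral (fun x => u x ^ 2 * q x) = 0 := by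
    have h7 : X.integral (fun x => u x ^ 2 * q x) = ∫ x in X.cell,
        (η₁ x * (u x * q x) - η₂ x * (u x * q x) - a * (u x * q x)) := by
      rw [integral]
      congr 1
      ext x
      simp only [hu]
      ring
    rw [h7, integral_sub (hi _ ((h₁.1.mul hσ).sub (h₂.1.mul hσ))) (hi _ (hσ.const_mul a)),
      integral_sub (hi _ (h₁.1.mul hσ)) (hi _ (h₂.1.mul hσ)), integral_const_mul]
    simp only [integral] at h5 hu0
    rw [h5, hu0, sub_self, mul_zero, sub_zero]
  filter_upwards [ae_eq_zero_of_integral_mul_eq_zero hq (hus.continuousOn.pow 2)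
    (fun x _ => sq_nonneg _) h6] with x hx
  have : u x = 0 := pow_eq_zero_iff two_ne_zero |>.1 hx
  simp only [hu] at this
  linarith

/-- The potential of the Wasserstein gradient has the gradient of the first variation. -/
theorem ae_grad_eq_of_metric_eq {q : Density X} (hq : ∀ x ∈ interior X.cover, 0 < q x)
    {f Ψ : EuclideanSpace ℝ (Fin d) → ℝ} (hf : X.IsTangentPotential q f)
    (hΨ : X.IsTangentPotential q Ψ)
    (h : ∀ Φ, X.IsTangentPotential q Φ →
      X.metric q Ψ Φ = X.integral fun x => f x * X.tangent q Φ x) :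
    ∀ᵐ x ∂(volume.restrict X.cell), X.grad Ψ x = X.grad f x := by
  have hgrad : ∀ x ∈ X.cover, X.grad (fun x => Ψ x - f x) x = X.grad Ψ x - X.grad f x :=
    fun x hx => grad_sub hx (hΨ.1.differentiableWithinAt hx) (hf.1.differentiableWithinAt hx)
  -- Tested against `Ψ - f`, the gradient equation becomes `∫ ‖∇Ψ - ∇f‖² q = 0` after integration by
  -- parts.
  have hg : X.IsTangentPotential q fun x => Ψ x - f x := by
    refine ⟨hΨ.1.sub hf.1, fun x hx n hn => ?_⟩
    rw [hgrad x hx, inner_sub_left, mul_sub, hΨ.2 x hx n hn, hf.2 x hx n hn, sub_self]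
  have h1 := h _ hg
  rw [integral_mul_tangent hg hf.1] at h1
  have hc : ∀ u v : EuclideanSpace ℝ (Fin d) → ℝ, X.IsSmooth u → X.IsSmooth v →
      Integrable (fun x => ⟪X.grad u x, X.grad v x⟫ * q x) (volume.restrict X.cell) :=
    fun u v hu hv => integrableOn_cell ((hu.grad_contDiffOn.continuousOn.inner
      hv.grad_contDiffOn.continuousOn).mul q.smooth.continuousOn)
  have h2 : X.integral (fun x => ‖X.grad Ψ x - X.grad f x‖ ^ 2 * q x) = 0 := by
    have h3 : X.integral (fun x => ‖X.grad Ψ x - X.grad f x‖ ^ 2 * q x) = ∫ x in X.cell,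
        (⟪X.grad Ψ x, X.grad (fun x => Ψ x - f x) x⟫ * q x -
          ⟪X.grad (fun x => Ψ x - f x) x, X.grad f x⟫ * q x) := by
      refine integral_congr fun x hx => ?_
      rw [hgrad x hx, real_inner_comm (X.grad f x), ← sub_mul, ← inner_sub_left,
        real_inner_self_eq_norm_sq]
    rw [h3, integral_sub (hc _ _ hΨ.1 hg.1) (hc _ _ hg.1 hf.1)]
    exact sub_eq_zero.2 h1
  filter_upwards [ae_eq_zero_of_integral_mul_eq_zero hq
    ((hΨ.1.grad_contDiffOn.continuousOn.sub hf.1.grad_contDiffOn.continuousOn).norm.pow 2)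
    (fun x _ => sq_nonneg _) h2] with x hx
  exact sub_eq_zero.1 (norm_eq_zero.1 (pow_eq_zero_iff two_ne_zero |>.1 hx))

end SampleSpace

/-! ### The formula for the transport Bregman divergence. -/

theorem mainTheorem10 {d : ℕ} (X : SampleSpace d) (F : SampleSpace.Density X → ℝ)
    (p q : SampleSpace.Density X) (hq : ∀ x ∈ interior X.cover, 0 < q x)
    (f : EuclideanSpace ℝ (Fin d) → ℝ) (hf : X.IsFirstVariation F q f)
    (hflux : X.IsTangentPotential q f)
    (Φ : EuclideanSpace ℝ (Fin d) → ℝ) (hΦ : X.IsTransportPotential q p Φ) :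
    X.IsWassersteinGradient q f (X.tangent q f) ∧
    (∃ η, X.IsFirstVariation (fun r => X.wassersteinDist p r ^ 2) q η) ∧
    ∀ ζ η : EuclideanSpace ℝ (Fin d) → ℝ,
      X.IsWassersteinGradient q f ζ →
      X.IsFirstVariation (fun r => X.wassersteinDist p r ^ 2) q η →
      X.transportBregman F p q f Φ =
        F p - F q + (1 / 2) * X.integral (fun x => ζ x * η x) := by
  have hη₀ := hΦ.isFirstVariation hq
  refine ⟨SampleSpace.isWassersteinGradient_tangent hflux, ⟨_, hη₀⟩, fun ζ η hζ hη => ?_⟩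
  obtain ⟨Ψ, hΨ, hζΨ, hmetric⟩ := hζ
  obtain ⟨a, ha⟩ := hη.ae_eq_add_const hq hη₀
  have hgrad := SampleSpace.ae_grad_eq_of_metric_eq hq hflux hΨ hmetric
  have h1 : X.integral (fun x => ζ x * η x) =
      X.integral fun x => (‖x‖ ^ 2 - 2 * Φ x + a) * X.tangent q Ψ x := by
    refine integral_congr_ae ?_
    filter_upwards [ha, ae_restrict_mem X.measurableSet_cell] with x hx hxc
    rw [hζΨ x (X.cell_subset_cover hxc), hx, mul_comm]
  rw [h1, SampleSpace.integral_mul_tangent hΨ (hη₀.1.add (SampleSpace.IsSmooth.const a))]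
  -- The additive constant drops out under the gradient, and `∇Ψ` may be replaced by `∇f` almost
  -- everywhere.
  have h2 : X.metric q Ψ (fun x => ‖x‖ ^ 2 - 2 * Φ x + a) =
      ∫ x in X.cell, (-2) * (⟪X.grad f x, X.grad Φ x - x⟫ * q x) := by
    refine integral_congr_ae ?_
    filter_upwards [hgrad, ae_restrict_mem X.measurableSet_cell] with x hx hxc
    have h3 : X.grad (fun x => ‖x‖ ^ 2 - 2 * Φ x + a) x = (2 : ℝ) • (x - X.grad Φ x) := by
      rw [← hΦ.grad_norm_sq_sub (X.cell_subset_cover hxc)]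
      simp only [SampleSpace.grad, gradientWithin, fderivWithin_add_const]
    rw [hx, h3, real_inner_smul_right, ← neg_sub (X.grad Φ x) x, inner_neg_right]
    ring
  rw [h2, integral_const_mul, SampleSpace.transportBregman, SampleSpace.integral]
  ring
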